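/- For an integer $d\ge 1$ identify quadratic forms in $d$ variables with real symmetric $d\times d$ matrices $Q$, and write $Q[x]=x^tQx$. For positive definite $Q$ let $\lambda_1(Q)=\min_{x\in\mathbb Z^d\setminus\{0\}}Q[x]$ and $\mathrm{Min}\,Q=\{x\in\mathbb Z^d: Q[x]=\lambda_1(Q)\}$. A positive definite $Q$ is called perfect if $Q'=Q$ is the only real symmetric matrix $Q'$ with $Q'[x]=\lambda_1(Q)$ for all $x\in\mathrm{Min}\,Q$. Two positive definite forms $Q,Q'$ are similar if $\alpha Q'=U^tQU$ for some real $\alpha>0$ and some $U\in\mathrm{GL}_d(\mathbb Z)$. Let $p_d$ be the number of similarity classes of perfect forms in $d$ variables. Then $p_d$ is finite for every $d\ge1$, and $p_d\le e^{O(d^2\log d)}$, that is, there is a constant $C$ such that $p_d\le e^{C d^2\log d}$ for all $d\ge 1$. More precisely, for every $d\ge 1$, $$p_d\le\frac{(n-1)!}{\Gamma\left(\frac n2+\frac12\right)}\cdot\sqrt{\frac{\pi^{n-1}}{2^{7n-d}}\cdot\frac{(d-1)^{n-1}}{d^n}}\cdot\bigl(d^3(d+7)\bigr)^n,\qquad n=\binom{d+1}{2},$$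 where $0^0=1$ for $d=1$. -/

import Mathlib

open Matrix

namespace PerfectForms

noncomputable section

/-- The quadratic form in `d` variables is represented by its real symmetric matrix `Q`;
this is the value `Q[x] = xᵗ Q x` at an integral vector `x`. -/
def evalInt {d : ℕ} (Q : Matrix (Fin d) (Fin d) ℝ) (x : Fin d → ℤ) : ℝ :=
  (fun i => (x i : ℝ)) ⬝ᵥ (Q *ᵥ fun i => (x i : ℝ))

/-- The arithmetical minimum `λ₁(Q)`: the infimum (a minimum if `Q` is positive definite and
`d ≥ 1`) of `Q[x]` over the nonzero integral vectors `x`. -/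
def arithMin {d : ℕ} (Q : Matrix (Fin d) (Fin d) ℝ) : ℝ :=
  sInf {r : ℝ | ∃ x : Fin d → ℤ, x ≠ 0 ∧ evalInt Q x = r}

/-- The set `Min Q` of minimal vectors of `Q`. -/
def minVectors {d : ℕ} (Q : Matrix (Fin d) (Fin d) ℝ) : Set (Fin d → ℤ) :=
  {x | evalInt Q x = arithMin Q}

/-- `Q` is a perfect form: it is positive definite, and it is the only symmetric matrix that
takes the value `λ₁(Q)` at all minimal vectors of `Q`. (`Matrix.PosDef` includes symmetry.) -/
def IsPerfect {d : ℕ} (Q : Matrix (Fin d) (Fin d) ℝ) : Prop :=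
  Q.PosDef ∧ ∀ Q' : Matrix (Fin d) (Fin d) ℝ, Q'.IsSymm →
    (∀ x ∈ minVectors Q, evalInt Q' x = arithMin Q) → Q' = Q

/-- Arithmetical equivalence: `Q' = Uᵗ Q U` for some `U ∈ GL_d(ℤ)`. -/
def ArithEquiv {d : ℕ} (Q Q' : Matrix (Fin d) (Fin d) ℝ) : Prop :=
  ∃ U : GL (Fin d) ℤ,
    Q' = ((U : Matrix (Fin d) (Fin d) ℤ).map (Int.cast : ℤ → ℝ))ᵀ * Q *
      (U : Matrix (Fin d) (Fin d) ℤ).map (Int.cast : ℤ → ℝ)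

/-- Similarity: `Q` is arithmetically equivalent to `α Q'` for some `α > 0`. -/
def Similar {d : ℕ} (Q Q' : Matrix (Fin d) (Fin d) ℝ) : Prop :=
  ∃ α : ℝ, 0 < α ∧ ArithEquiv Q (α • Q')

theorem map_cast_mul {d : ℕ} (A B : Matrix (Fin d) (Fin d) ℤ) :
    (A * B).map (Int.cast : ℤ → ℝ) = A.map (Int.cast : ℤ → ℝ) * B.map (Int.cast : ℤ → ℝ) :=
  Matrix.map_mul (f := Int.castRingHom ℝ)

theorem ArithEquiv.refl {d : ℕ} (Q : Matrix (Fin d) (Fin d) ℝ) : ArithEquiv Q Q :=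
  ⟨1, by simp [Matrix.map_one]⟩

theorem ArithEquiv.symm {d : ℕ} {Q Q' : Matrix (Fin d) (Fin d) ℝ} (h : ArithEquiv Q Q') :
    ArithEquiv Q' Q := by
  obtain ⟨U, rfl⟩ := h
  refine ⟨U⁻¹, ?_⟩
  set A := (U : Matrix (Fin d) (Fin d) ℤ).map (Int.cast : ℤ → ℝ) with hA
  set B := ((U⁻¹ : GL (Fin d) ℤ) : Matrix (Fin d) (Fin d) ℤ).map (Int.cast : ℤ → ℝ) with hB
  have hAB : A * B = 1 := by
    rw [hA, hB, ← map_cast_mul, Units.mul_inv]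
    simp [Matrix.map_one]
  have hT : Bᵀ * Aᵀ = 1 := by rw [← Matrix.transpose_mul, hAB, Matrix.transpose_one]
  calc Q = (Bᵀ * Aᵀ) * Q * (A * B) := by rw [hAB, hT, Matrix.one_mul, Matrix.mul_one]
    _ = Bᵀ * (Aᵀ * Q * A) * B := by simp only [Matrix.mul_assoc]

theorem ArithEquiv.trans {d : ℕ} {Q Q' Q'' : Matrix (Fin d) (Fin d) ℝ}
    (h : ArithEquiv Q Q') (h' : ArithEquiv Q' Q'') : ArithEquiv Q Q'' := by
  obtain ⟨U, rfl⟩ := h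
  obtain ⟨V, rfl⟩ := h'
  refine ⟨U * V, ?_⟩
  rw [Units.val_mul, map_cast_mul, Matrix.transpose_mul]
  simp only [Matrix.mul_assoc]

theorem ArithEquiv.smul {d : ℕ} {Q Q' : Matrix (Fin d) (Fin d) ℝ} (c : ℝ)
    (h : ArithEquiv Q Q') : ArithEquiv (c • Q) (c • Q') := by
  obtain ⟨U, rfl⟩ := h
  exact ⟨U, by simp⟩

theorem Similar.refl {d : ℕ} (Q : Matrix (Fin d) (Fin d) ℝ) : Similar Q Q :=
  ⟨1, one_pos, by simpa using ArithEquiv.refl Q⟩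

theorem Similar.symm {d : ℕ} {Q Q' : Matrix (Fin d) (Fin d) ℝ} (h : Similar Q Q') :
    Similar Q' Q := by
  obtain ⟨α, hα, h⟩ := h
  refine ⟨α⁻¹, inv_pos.mpr hα, ?_⟩
  simpa [smul_smul, inv_mul_cancel₀ hα.ne'] using h.symm.smul α⁻¹

theorem Similar.trans {d : ℕ} {Q Q' Q'' : Matrix (Fin d) (Fin d) ℝ}
    (h : Similar Q Q') (h' : Similar Q' Q'') : Similar Q Q'' := by
  obtain ⟨α, hα, h⟩ := h
  obtain ⟨β, hβ, h'⟩ := h'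
  refine ⟨α * β, mul_pos hα hβ, ?_⟩
  have := h.trans (h'.smul α)
  rwa [smul_smul] at this

/-- Similarity as an equivalence relation on the perfect forms in `d` variables. -/
def similarSetoid (d : ℕ) : Setoid {Q : Matrix (Fin d) (Fin d) ℝ // IsPerfect Q} where
  r Q Q' := Similar Q.1 Q'.1
  iseqv := ⟨fun Q => Similar.refl Q.1, Similar.symm, Similar.trans⟩

/-- The similarity classes of perfect forms in `d` variables. -/
abbrev PerfectClass (d : ℕ) : Type := Quotient (similarSetoid d)

/-- The number `p_d` of similarity classes of perfect forms in `d` variables. -/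
def numPerfect (d : ℕ) : ℕ := Nat.card (PerfectClass d)

end

end PerfectForms

open Matrix

namespace PerfectForms

open Module MeasureTheory Submodule

/-! The argument is Voronoi's cone picture plus a volume comparison. A perfect form is determined by
its minimal vectors `x`, so the matrices `x xᵗ` span the space of symmetric matrices, of dimension
`n`; choosing `n` independent ones gives an open simplicial cone. If two such cones meet, evaluating
both forms at the common point shows that the minimum of each is attained at the chosen vectors of
the other, and the forms are proportional (`ReducedSimplex.similar_of_sum_eq`). Thus representatives
of distinct similarity classes give disjoint cones.

The measure is `exp(-trace) dz`. A simplicial cone has mass `|det| ∏ ‖x‖⁻²`. The determinant is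
bounded below because it is a nonzero integer times a fixed factor. The norms are bounded above by
moving each form within its `GL_d(ℤ)`-class: `exists_reduced_basis` makes all minimal vectors
satisfy `‖x‖² ≤ d³(d+7)/8`. It works by induction on the rank, splitting off a short primitive
vector of the dual lattice, which Minkowski's theorem supplies.

All the cones lie in the circular cone `‖z‖ ≤ trace z`, whose mass is a ball volume times a Gamma
integral (`lintegral_circularCone_le`). Dividing the total mass by the least mass of a cone gives
the explicit bound for `d ≥ 2`; the case `d = 1` is direct. -/

/-! ### Short vectors in the dual lattice -/

/-- Minkowski's theorem on linear forms. -/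
theorem exists_int_ne_zero_abs_mulVec_le {d : ℕ} [NeZero d] (A : Matrix (Fin d) (Fin d) ℝ)
    (hA : A.det ≠ 0) {c : ℝ} (hc : 0 ≤ c) (h : |A.det| ≤ c ^ d) :
    ∃ x : Fin d → ℤ, x ≠ 0 ∧ ∀ i, |(A *ᵥ fun j => (x j : ℝ)) i| ≤ c := by
  have hli : LinearIndependent ℝ (fun i => Aᵀ i) :=
    Matrix.linearIndependent_rows_of_det_ne_zero (by rwa [Matrix.det_transpose])
  let b : Basis (Fin d) ℝ (Fin d → ℝ) :=
    basisOfLinearIndependentOfCardEqFinrank hli (by simp)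
  have hb : ⇑b = fun i => Aᵀ i := coe_basisOfLinearIndependentOfCardEqFinrank _ _
  have hvol : volume (ZSpan.fundamentalDomain b) * 2 ^ finrank ℝ (Fin d → ℝ) ≤
      volume (Set.Icc (fun _ : Fin d => -c) (fun _ => c)) := by
    rw [ZSpan.volume_fundamentalDomain, Real.volume_Icc_pi, hb]
    change ENNReal.ofReal |Aᵀ.det| * _ ≤ _
    rw [Matrix.det_transpose, Finset.prod_const, finrank_fin_fun, Finset.card_univ,
      Fintype.card_fin, ← ENNReal.ofReal_pow (by linarith),
      show c - -c = c * 2 by ring, mul_pow, ENNReal.ofReal_mul (by positivity)]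
    gcongr
    rw [ENNReal.ofReal_pow (by norm_num)]
    simp
  have : Countable (span ℤ (Set.range b)).toAddSubgroup :=
    inferInstanceAs (Countable (span ℤ (Set.range b)))
  -- The cube is compact, so the non-strict volume inequality suffices.
  obtain ⟨⟨x, hx⟩, hx0, hxs⟩ := exists_ne_zero_mem_lattice_of_measure_mul_two_pow_le_measure
    (L := (span ℤ (Set.range b)).toAddSubgroup)
    (ZSpan.isAddFundamentalDomain b volume)
    (s := Set.Icc (fun _ : Fin d => -c) (fun _ => c))
    (fun x hx => ⟨fun i => by simpa using hx.2 i, fun i => by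
      have := hx.1 i; simp only [Pi.neg_apply]; linarith⟩) (convex_Icc _ _) isCompact_Icc hvol
  obtain ⟨y, rfl⟩ := (mem_span_range_iff_exists_fun ℤ).1 hx
  have hy : (A *ᵥ fun j => (y j : ℝ)) = ∑ i, y i • b i := by
    ext i
    simp [Matrix.mulVec, dotProduct, hb, mul_comm]
  refine ⟨y, ?_, fun i => ?_⟩
  · rintro rfl
    simp at hx0
  · rw [hy]
    exact abs_le.2 ⟨hxs.1 i, hxs.2 i⟩

theorem sum_sq_le_of_abs_le {d : ℕ} {v : Fin d → ℝ} {c : ℝ} (h : ∀ i, |v i| ≤ c) :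
    ∑ i, v i ^ 2 ≤ d * c ^ 2 := by
  calc ∑ i, v i ^ 2 ≤ ∑ _i : Fin d, c ^ 2 :=
        Finset.sum_le_sum fun i _ => sq_le_sq' (abs_le.1 (h i)).1 (abs_le.1 (h i)).2
    _ = d * c ^ 2 := by simp

/-- If all nonzero vectors of a lattice of rank `d` have length at least `l`, then there is a
nonzero integral linear form of norm at most `d / l` on the lattice. -/
theorem exists_int_form_norm_le {V : Type*} [NormedAddCommGroup V] [InnerProductSpace ℝ V] {d : ℕ}
    [NeZero d] (b : Basis (Fin d) ℝ V) {l : ℝ} (hl : 0 < l)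
    (hb : ∀ y : Fin d → ℤ, y ≠ 0 → l ≤ ‖∑ i, (y i : ℝ) • b i‖) :
    ∃ y : Fin d → ℤ, y ≠ 0 ∧ ∀ x : V, |∑ i, y i * b.repr x i| ≤ d / l * ‖x‖ := by
  have : FiniteDimensional ℝ V := b.finiteDimensional_of_finite
  have hd : (0 : ℝ) < d := by exact_mod_cast Nat.pos_of_ne_zero (NeZero.ne d)
  have hfin : finrank ℝ V = d := by simpa using finrank_eq_card_basis b
  let o : OrthonormalBasis (Fin d) ℝ V := (stdOrthonormalBasis ℝ V).reindex (finCongr hfin)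
  let A : Matrix (Fin d) (Fin d) ℝ := o.toBasis.toMatrix b
  let A' : Matrix (Fin d) (Fin d) ℝ := b.toMatrix o.toBasis
  have hAA' : A * A' = 1 := Basis.toMatrix_mul_toMatrix_flip _ _
  have hdet : A.det * A'.det = 1 := by rw [← Matrix.det_mul, hAA', Matrix.det_one]
  have hA0 : A.det ≠ 0 := left_ne_zero_of_mul_eq_one hdet
  have hA0' : A'.det ≠ 0 := right_ne_zero_of_mul_eq_one hdet
  -- With this `c`, Minkowski's theorem applies to `A` with bound `c` and to the dual matrix with
  -- bound `c⁻¹`. The lattice vector gives `l² ≤ d c²`, while the dual vector has squared norm at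
  -- most `d c⁻² ≤ d² / l²`.
  set c : ℝ := |A.det| ^ ((d : ℝ)⁻¹) with hc
  have hcpos : 0 < c := Real.rpow_pos_of_pos (abs_pos.2 hA0) _
  have hcd : c ^ d = |A.det| := by
    rw [hc, ← Real.rpow_natCast, ← Real.rpow_mul (abs_nonneg _), inv_mul_cancel₀ hd.ne',
      Real.rpow_one]
  have hcd' : (c⁻¹) ^ d = |A'.det| := by
    rw [inv_pow, hcd, inv_eq_iff_eq_inv, ← abs_inv, eq_inv_of_mul_eq_one_left hdet]
  obtain ⟨x, hx0, hx⟩ := exists_int_ne_zero_abs_mulVec_le A hA0 hcpos.le hcd.ge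
  obtain ⟨y, hy0, hy⟩ := exists_int_ne_zero_abs_mulVec_le A'ᵀ (by rwa [Matrix.det_transpose])
    (inv_pos.2 hcpos).le (by rw [Matrix.det_transpose]; exact hcd'.ge)
  refine ⟨y, hy0, fun z => ?_⟩
  have h1 : l ^ 2 ≤ d * c ^ 2 := by
    refine le_trans ?_ (sum_sq_le_of_abs_le hx)
    have h2 := hb x hx0
    have h3 : ‖∑ i, (x i : ℝ) • b i‖ ^ 2 = ∑ i, (A *ᵥ fun j => (x j : ℝ)) i ^ 2 := by
      rw [← o.repr.norm_map, EuclideanSpace.norm_sq_eq]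
      refine Finset.sum_congr rfl fun i _ => ?_
      rw [Real.norm_eq_abs, sq_abs]
      congr 1
      simp [Matrix.mulVec, dotProduct, A, Basis.toMatrix_apply, mul_comm]
    rw [← h3]
    gcongr
  have h4 : ∑ i, y i * b.repr z i = ∑ i, (A'ᵀ *ᵥ fun j => (y j : ℝ)) i * o.repr z i := by
    have h5 : ∀ i, b.repr z i = ∑ j, A' i j * o.repr z j := by
      intro i
      have := congrFun (Basis.toMatrix_mulVec_repr o.toBasis b z) i
      rw [← this]
      simp [Matrix.mulVec, dotProduct, A']
    simp only [h5, Matrix.mulVec, dotProduct, Matrix.transpose_apply, Finset.mul_sum,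
      Finset.sum_mul]
    rw [Finset.sum_comm]
    exact Finset.sum_congr rfl fun i _ => Finset.sum_congr rfl fun j _ => by ring
  have h6 : (∑ i, y i * b.repr z i) ^ 2 ≤ (d * (c⁻¹) ^ 2) * ‖z‖ ^ 2 := by
    rw [h4]
    refine (Finset.sum_mul_sq_le_sq_mul_sq _ _ _).trans ?_
    have h7 : ‖z‖ ^ 2 = ∑ i, o.repr z i ^ 2 := by
      rw [← o.repr.norm_map, EuclideanSpace.norm_sq_eq]
      simp
    rw [h7]
    gcongr
    exact sum_sq_le_of_abs_le hy
  refine abs_le_of_sq_le_sq ?_ (by positivity)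
  refine h6.trans ?_
  rw [mul_pow]
  gcongr
  rw [inv_pow, div_pow, ← div_eq_mul_inv, div_le_div_iff₀ (by positivity) (by positivity)]
  nlinarith

/-! ### Primitive integral linear forms -/

/-- Every nonzero integral vector is an integral multiple of a primitive one. -/
theorem exists_eq_smul_primitive {d : ℕ} {y : Fin d → ℤ} (hy : y ≠ 0) :
    ∃ (k : ℤ) (y' w : Fin d → ℤ), k ≠ 0 ∧ (∀ i, y i = k * y' i) ∧ ∑ i, y' i * w i = 1 := by
  let I : Ideal ℤ := Ideal.span (Set.range y)
  obtain ⟨k, hk⟩ := (IsPrincipalIdealRing.principal I).principal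
  have hdvd : ∀ i, k ∣ y i := fun i => by
    have : y i ∈ I := Ideal.subset_span ⟨i, rfl⟩
    rw [hk] at this
    exact Ideal.mem_span_singleton.1 this
  choose y' hy' using hdvd
  have hk0 : k ≠ 0 := by
    rintro rfl
    exact hy (funext fun i => by simpa using hy' i)
  have hkI : k ∈ I := by rw [hk]; exact Submodule.mem_span_singleton_self k
  obtain ⟨w, hw⟩ := (mem_span_range_iff_exists_fun ℤ).1 hkI
  refine ⟨k, y', w, hk0, hy', mul_left_cancel₀ hk0 ?_⟩
  rw [mul_one, Finset.mul_sum]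
  conv_rhs => rw [← hw]
  exact Finset.sum_congr rfl fun i _ => by rw [smul_eq_mul, hy' i]; ring

/-- A primitive integral linear form is the first coordinate in some integral basis. -/
theorem exists_int_basis_of_primitive {d : ℕ} (y w : Fin (d + 1) → ℤ) (h : ∑ i, y i * w i = 1) :
    ∃ e : Basis (Fin (d + 1)) ℤ (Fin (d + 1) → ℤ),
      ∑ i, y i * e 0 i = 1 ∧ ∀ j : Fin d, ∑ i, y i * e j.succ i = 0 := by
  let g : (Fin (d + 1) → ℤ) →ₗ[ℤ] ℤ := Fintype.linearCombination ℤ y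
  have hg : ∀ x, g x = ∑ i, y i * x i := fun x => by
    simp [g, Fintype.linearCombination_apply, mul_comm]
  have hgw : g w = 1 := by rw [hg, h]
  have hsurj : LinearMap.range g = ⊤ :=
    LinearMap.range_eq_top.2 fun k => ⟨k • w, by rw [map_smul, hgw, smul_eq_mul, mul_one]⟩
  have hrank : finrank ℤ (LinearMap.ker g) = d := by
    have h1 := Submodule.finrank_quotient_add_finrank (LinearMap.ker g)
    rw [g.quotKerEquivRange.finrank_eq, hsurj, finrank_top, finrank_self, finrank_fin_fun] at h1
    omega
  -- Since `g w = 1`, the vector `w` splits off: it completes any basis of the kernel.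
  let c : Basis (Fin d) ℤ (LinearMap.ker g) := finBasisOfFinrankEq ℤ _ hrank
  let e := Basis.mkFinCons w c
    (fun k x hx hkx => by
      have := congrArg g hkx
      rwa [map_add, map_smul, hgw, LinearMap.mem_ker.1 hx, map_zero, add_zero, smul_eq_mul,
        mul_one] at this)
    (fun z => ⟨-g z, by
      rw [LinearMap.mem_ker, map_add, map_smul, hgw, smul_eq_mul, mul_one, add_neg_cancel]⟩)
  have he : ⇑e = Fin.cons w ((↑) ∘ c) := Basis.coe_mkFinCons _ _ _ _
  refine ⟨e, by rw [he]; exact h, fun j => ?_⟩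
  rw [he, ← hg]
  exact (c j).2

/-! ### Reduced bases of lattices -/

/-- The constant in `exists_reduced_basis`. -/
noncomputable def reductionConst (d : ℕ) : ℝ :=
  ∑ m ∈ Finset.range d, ((m : ℝ) + 1) ^ 2 * ((m : ℝ) + 4) / 4

theorem reductionConst_succ_div (d : ℕ) (l : ℝ) :
    reductionConst d / l ^ 2 + ((d + 1 : ℝ) / l) ^ 2 * (d + 4) / 4 =
      reductionConst (d + 1) / l ^ 2 := by
  rw [reductionConst, reductionConst, Finset.sum_range_succ]
  ring

theorem reductionConst_nonneg (d : ℕ) : 0 ≤ reductionConst d :=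
  Finset.sum_nonneg fun _ _ => by positivity

/-- The sum has a closed form, a quartic polynomial with leading coefficient `1/16`; the cruder
bound is attained at `d = 1`. -/
theorem reductionConst_le (d : ℕ) (hd : 1 ≤ d) :
    reductionConst d ≤ (d : ℝ) ^ 3 * ((d : ℝ) + 7) / 8 := by
  have h : reductionConst d = (d : ℝ) * (d + 1) * (d ^ 2 + 5 * d + 2) / 16 := by
    clear hd
    induction d with
    | zero => simp [reductionConst]
    | succ d ih =>
      rw [reductionConst, Finset.sum_range_succ, ← reductionConst, ih]
      push_cast
      ring
  have hd' : (1 : ℝ) ≤ d := by exact_mod_cast hd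
  rw [h]
  nlinarith [mul_nonneg (sub_nonneg.2 hd') (sub_nonneg.2 hd'), mul_nonneg (sq_nonneg (d : ℝ))
    (sub_nonneg.2 hd'), pow_pos (lt_of_lt_of_le one_pos hd') 3, pow_pos (lt_of_lt_of_le one_pos hd') 2,
    mul_nonneg (pow_nonneg (zero_le_one.trans hd') 3) (sub_nonneg.2 hd')]

/-- Estimate of the coordinates of a vector with respect to a lifted basis. -/
theorem sum_lift_sq_le {d : ℕ} {t D q₁ q₂ T : ℝ} {p c : Fin d → ℝ} (hq₁ : 0 ≤ q₁) (hq₂ : 0 ≤ q₂)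
    (hT : 0 ≤ T) (hp : ∑ i, p i ^ 2 ≤ T * q₁) (ht : t ^ 2 ≤ D * q₂)
    (hD : 0 ≤ D) (hc : ∀ i, |c i| ≤ 1 / 2) :
    t ^ 2 + ∑ i, (p i - t * c i) ^ 2 ≤ (T + D * (d + 4) / 4) * (q₁ + q₂) := by
  have hc2 : ∑ i, (t * c i) ^ 2 ≤ d / 4 * (D * q₂) := by
    calc ∑ i, (t * c i) ^ 2 ≤ ∑ _i : Fin d, (D * q₂) * (1 / 4) := by
          refine Finset.sum_le_sum fun i _ => ?_
          rw [mul_pow]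
          have : c i ^ 2 ≤ 1 / 4 := by
            have := sq_le_sq' (abs_le.1 (hc i)).1 (abs_le.1 (hc i)).2
            linarith
          gcongr
      _ = d / 4 * (D * q₂) := by simp; ring
  have hexp : ∑ i, (p i - t * c i) ^ 2 =
      ∑ i, p i ^ 2 + ∑ i, (t * c i) ^ 2 - 2 * ∑ i, p i * (t * c i) := by
    rw [Finset.mul_sum, ← Finset.sum_add_distrib, ← Finset.sum_sub_distrib]
    exact Finset.sum_congr rfl fun i _ => by ring
  have hcs := Finset.sum_mul_sq_le_sq_mul_sq Finset.univ p fun i => t * c i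
  set P := ∑ i, p i ^ 2
  set C := ∑ i, (t * c i) ^ 2
  set S := ∑ i, p i * (t * c i)
  set E : ℝ := d / 4 * D with hE
  have hE0 : 0 ≤ E := by positivity
  have hP0 : 0 ≤ P := Finset.sum_nonneg fun _ _ => sq_nonneg _
  -- Swapping `q₁` and `q₂` between the factors lets the arithmetic-geometric mean inequality bound
  -- the cross term by exactly the mixed terms of `(T + E) * (q₁ + q₂)`.
  have hcs' : S ^ 2 ≤ (T * q₂) * (E * q₁) := by
    calc S ^ 2 ≤ P * C := hcs
      _ ≤ (T * q₁) * (d / 4 * (D * q₂)) := by gcongr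
      _ = _ := by rw [hE]; ring
  have hS : -2 * S ≤ T * q₂ + E * q₁ := by
    have h0 : 0 ≤ T * q₂ + E * q₁ := by positivity
    have : (2 * S) ^ 2 ≤ (T * q₂ + E * q₁) ^ 2 := by
      nlinarith [sq_nonneg (T * q₂ - E * q₁)]
    have := abs_le_of_sq_le_sq this h0
    have := neg_abs_le (2 * S)
    linarith
  rw [hexp]
  have h1 : C ≤ E * q₂ := by rw [hE]; linarith
  have h2 : 0 ≤ D * q₁ := by positivity
  have h3 : (T + D * (d + 4) / 4) * (q₁ + q₂) =
      T * q₁ + T * q₂ + (E * q₁ + E * q₂) + (D * q₁ + D * q₂) := by rw [hE]; ring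
  rw [h3]
  linarith

/-- A lattice of rank `d` whose nonzero vectors have length at least `l` has a basis with respect
to which all vectors have small coordinates. -/
theorem exists_reduced_basis {l : ℝ} (hl : 0 < l) (d : ℕ) :
    ∀ (V : Type) [NormedAddCommGroup V] [InnerProductSpace ℝ V] (b : Basis (Fin d) ℝ V),
      (∀ x ∈ span ℤ (Set.range b), x ≠ 0 → l ≤ ‖x‖) →
      ∃ b' : Basis (Fin d) ℝ V, span ℤ (Set.range b') = span ℤ (Set.range b) ∧
        ∀ x, ∑ i, b'.repr x i ^ 2 ≤ reductionConst d / l ^ 2 * ‖x‖ ^ 2 := by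
  induction d with
  | zero =>
    intro V _ _ b _
    exact ⟨b, rfl, fun x => by simp [reductionConst]⟩
  | succ d ih =>
    intro V _ _ b hb
    have : FiniteDimensional ℝ V := b.finiteDimensional_of_finite
    have hfin : finrank ℝ V = d + 1 := by simpa using finrank_eq_card_basis b
    obtain ⟨y₀, hy₀, hy₀l⟩ := exists_int_form_norm_le b hl fun y hy => hb _
      (Submodule.sum_mem _ fun i _ => by
        rw [Int.cast_smul_eq_zsmul]
        exact Submodule.smul_mem _ _ (subset_span ⟨i, rfl⟩))
      (fun h0 => hy (funext fun i => by
        have := Fintype.linearIndependent_iff.1 b.linearIndependent (fun i => (y i : ℝ)) h0 i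
        exact_mod_cast this))
    -- Dividing the short dual vector by its content only shortens it, and makes it a coordinate of
    -- a lattice basis.
    obtain ⟨k, y, w, hk, hky, hyw⟩ := exists_eq_smul_primitive hy₀
    obtain ⟨e, he0, hes⟩ := exists_int_basis_of_primitive y w hyw
    let f : V →ₗ[ℝ] ℝ := ∑ i, (y i : ℝ) • b.coord i
    have hf : ∀ x, f x = ∑ i, y i * b.repr x i := fun x => by simp [f]
    have hfl : ∀ x, |f x| ≤ (d + 1 : ℝ) / l * ‖x‖ := fun x => by
      have h1 := hy₀l x
      have h2 : ∑ i, (y₀ i : ℝ) * b.repr x i = k * f x := by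
        rw [hf, Finset.mul_sum]
        exact Finset.sum_congr rfl fun i _ => by rw [hky i]; push_cast; ring
      rw [h2, abs_mul] at h1
      have h3 : (1 : ℝ) ≤ |(k : ℝ)| := by exact_mod_cast Int.one_le_abs hk
      push_cast at h1
      nlinarith [abs_nonneg (f x)]
    -- In the resulting basis `β`, the form `f` is `1` on `β 0` and `0` on the rest, which span the
    -- sublattice in `ker f` to which induction applies.
    let e' : Basis (Fin (d + 1)) ℤ (span ℤ (Set.range b)) :=
      e.map (b.restrictScalars ℤ).equivFun.symm
    let β : Basis (Fin (d + 1)) ℝ V := e'.ofZLatticeBasis ℝ (span ℤ (Set.range b))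
    have hβspan : span ℤ (Set.range β) = span ℤ (Set.range b) := e'.ofZLatticeBasis_span ℝ _
    have hfβ : ∀ j, f (β j) = ∑ i, y i * e j i := fun j => by
      have h1 : β j = ∑ i, (e j i : ℝ) • b i := by
        simp only [β, Basis.ofZLatticeBasis_apply, e', Basis.map_apply, Basis.equivFun_symm_apply]
        simp [Int.cast_smul_eq_zsmul]
      rw [hf, h1]
      push_cast
      refine Finset.sum_congr rfl fun i _ => ?_
      rw [map_sum, Finsupp.finsetSum_apply]
      simp [Finsupp.single_apply]
    have hfβ0 : f (β 0) = 1 := by rw [hfβ]; exact_mod_cast he0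
    have hfβs : ∀ j : Fin d, f (β j.succ) = 0 := fun j => by rw [hfβ]; exact_mod_cast hes j
    let W : Submodule ℝ V := LinearMap.ker f
    have hW : finrank ℝ W = d := by
      have h1 := LinearMap.finrank_range_add_finrank_ker f
      rw [LinearMap.range_eq_top.2 fun t => ⟨t • β 0, by simp [hfβ0]⟩, finrank_top, finrank_self,
        hfin] at h1
      change finrank ℝ (LinearMap.ker f) = d
      omega
    let γ₀ : Fin d → W := fun j => ⟨β j.succ, hfβs j⟩
    have hγ₀ : LinearIndependent ℝ γ₀ := by
      refine LinearIndependent.of_comp W.subtype ?_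
      exact β.linearIndependent.comp Fin.succ (Fin.succ_injective d)
    let γ : Basis (Fin d) ℝ W := basisOfLinearIndependentOfCardEqFinrank' γ₀ hγ₀ (by simp [hW])
    have hγ : ⇑γ = γ₀ := coe_basisOfLinearIndependentOfCardEqFinrank' _ _ _
    let ι : W →ₗ[ℤ] V := W.subtype.restrictScalars ℤ
    have hγspan : (span ℤ (Set.range γ)).map ι = span ℤ (Set.range fun j : Fin d => β j.succ) := by
      rw [Submodule.map_span, ← Set.range_comp, hγ]
      rfl
    have hγle : span ℤ (Set.range fun j : Fin d => β j.succ) ≤ span ℤ (Set.range β) :=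
      span_mono (by rintro _ ⟨j, rfl⟩; exact ⟨_, rfl⟩)
    obtain ⟨γ', hγ'span, hγ'⟩ := ih W γ fun x hx hx0 => by
      refine hb x ?_ (by simpa using hx0)
      rw [← hβspan]
      exact hγle (hγspan ▸ Submodule.mem_map_of_mem (f := ι) hx)
    have hγ'V : span ℤ (Set.range fun i => (γ' i : V)) =
        span ℤ (Set.range fun j : Fin d => β j.succ) := by
      rw [← hγspan, ← hγ'span, Submodule.map_span, ← Set.range_comp]
      rfl
    -- The component `u` of `β 0` orthogonal to `W` satisfies `f u = 1`, so `x = z + f x • u`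
    -- orthogonally with `z` in `W`.
    let p : W := W.orthogonalProjectionOnto (β 0)
    let u : V := β 0 - p
    have hu : ∀ x ∈ W, inner ℝ x u = 0 :=
      fun x hx => (W.sub_starProjection_mem_orthogonal (β 0)) x hx
    have hfp : ∀ x : W, f x = 0 := fun x => x.2
    have hfu : f u = 1 := by rw [map_sub, hfβ0, hfp, sub_zero]
    -- Size reduction: subtracting the rounded projection leaves `v = u + ∑ c i • γ' i` with `|c i|
    -- ≤ 1/2`, without changing the lattice.
    let k' : Fin d → ℤ := fun i => round (γ'.repr p i)
    let v : V := β 0 - ((∑ i, (k' i : ℝ) • γ' i : W) : V)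
    have hfv : f v = 1 := by rw [map_sub, hfβ0, hfp, sub_zero]
    let b' := Basis.mkFinCons v γ'
      (fun t x hx htx => by
        have := congrArg f htx
        rwa [map_add, map_smul, hfv, LinearMap.mem_ker.1 hx, map_zero, add_zero, smul_eq_mul,
          mul_one] at this)
      (fun z => ⟨-f z, by
        rw [LinearMap.mem_ker, map_add, map_smul, hfv, smul_eq_mul, mul_one, add_neg_cancel]⟩)
    have hb' : ⇑b' = Fin.cons v (fun i => (γ' i : V)) := Basis.coe_mkFinCons _ _ _ _
    refine ⟨b', ?_, fun x => ?_⟩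
    · have hv : β 0 - v ∈ span ℤ (Set.range fun i => (γ' i : V)) := by
        have : β 0 - v = ∑ i, k' i • (γ' i : V) := by
          simp [v, Int.cast_smul_eq_zsmul]
        rw [this]
        exact Submodule.sum_mem _ fun i _ => Submodule.smul_mem _ _ (subset_span ⟨i, rfl⟩)
      have hβr : Set.range β = insert (β 0) (Set.range fun j : Fin d => β j.succ) := by
        rw [← Fin.range_cons]
        congr 1
        exact (Fin.cons_self_tail β).symm
      rw [← hβspan, hb', hβr, Fin.range_cons, span_insert, span_insert, hγ'V]
      rw [hγ'V] at hv
      set S := span ℤ (Set.range fun j : Fin d => β j.succ)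
      refine le_antisymm (sup_le ?_ le_sup_right) (sup_le ?_ le_sup_right) <;>
        rw [span_singleton_le_iff_mem]
      · have : v = β 0 - (β 0 - v) := by abel
        rw [this]
        exact sub_mem (mem_sup_left (mem_span_singleton_self _)) (mem_sup_right hv)
      · have : β 0 = v + (β 0 - v) := by abel
        rw [this]
        exact add_mem (mem_sup_left (mem_span_singleton_self _)) (mem_sup_right hv)
    · let z : W := ⟨x - f x • u, by
        change f _ = 0
        rw [map_sub, map_smul, hfu, smul_eq_mul, mul_one, sub_self]⟩
      let c : Fin d → ℝ := fun i => γ'.repr p i - k' i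
      have hrepr : ⇑(b'.repr x) = Fin.cons (f x) (fun i => γ'.repr z i - f x * c i) := by
        have hx : x = ∑ i, (Fin.cons (f x) (fun i => γ'.repr z i - f x * c i) :
            Fin (d + 1) → ℝ) i • b' i := by
          rw [Fin.sum_univ_succ, hb']
          simp only [Fin.cons_zero, Fin.cons_succ, sub_smul, Finset.sum_sub_distrib, c, mul_sub]
          have h1 : ∑ i, γ'.repr z i • (γ' i : V) = z := by
            simpa only [map_sum, map_smul, Submodule.subtype_apply] using
              congrArg W.subtype (γ'.sum_repr z)
          have h2 : ∑ i, (f x * γ'.repr p i) • (γ' i : V) = f x • (p : V) := by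
            simpa only [map_sum, map_smul, Submodule.subtype_apply, Finset.smul_sum, ← mul_smul]
              using congrArg (fun q => f x • W.subtype q) (γ'.sum_repr p)
          have h3 : ∑ i, (f x * (k' i : ℝ)) • (γ' i : V) = f x • (β 0 - v) := by
            simp [v, Finset.smul_sum, mul_smul]
          rw [h1, h2, h3]
          simp only [z, u]
          module
        conv_lhs => rw [hx]
        exact b'.repr_sum_self _
      have hnorm : ‖x‖ ^ 2 = ‖z‖ ^ 2 + ‖f x • u‖ ^ 2 := by
        have h1 : x = (z : V) + f x • u := by simp [z]
        have h2 : inner ℝ (z : V) (f x • u) = 0 := by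
          rw [inner_smul_right, hu _ z.2, mul_zero]
        have := norm_add_sq_eq_norm_sq_add_norm_sq_of_inner_eq_zero (z : V) (f x • u) h2
        rw [← h1] at this
        simpa [sq] using this
      rw [hrepr, Fin.sum_univ_succ, hnorm]
      simp only [Fin.cons_zero, Fin.cons_succ]
      -- The norm bound on `f` is applied to the orthogonal component, on which `f` takes the same
      -- value as on `x`.
      have ht : f x ^ 2 ≤ ((d + 1 : ℝ) / l) ^ 2 * ‖f x • u‖ ^ 2 := by
        have := hfl (f x • u)
        rw [map_smul, hfu, smul_eq_mul, mul_one] at this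
        rw [← mul_pow, ← sq_abs]
        gcongr
      have := sum_lift_sq_le (c := c) (sq_nonneg _) (sq_nonneg _)
        (div_nonneg (reductionConst_nonneg d) (sq_nonneg l)) (hγ' z) ht (sq_nonneg _)
        fun i => abs_sub_round _
      refine this.trans (le_of_eq ?_)
      congr 1
      exact reductionConst_succ_div d l

/-! ### Reduction of positive definite forms -/

open scoped MatrixOrder Matrix.Norms.L2Operator in
theorem exists_eq_transpose_mul_self {d : ℕ} {Q : Matrix (Fin d) (Fin d) ℝ} (hQ : Q.PosDef) :
    ∃ B : Matrix (Fin d) (Fin d) ℝ, IsUnit B.det ∧ Q = Bᵀ * B := by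
  obtain ⟨B, hB⟩ := CStarAlgebra.nonneg_iff_eq_star_mul_self.mp hQ.posSemidef.nonneg
  rw [Matrix.star_eq_conjTranspose, Matrix.conjTranspose_eq_transpose_of_trivial] at hB
  refine ⟨B, ?_, hB⟩
  have h := hQ.isUnit
  rw [hB, Matrix.isUnit_iff_isUnit_det, Matrix.det_mul] at h
  exact isUnit_of_mul_isUnit_right h

theorem evalInt_transpose_mul_self {d : ℕ} (B : Matrix (Fin d) (Fin d) ℝ) (x : Fin d → ℤ) :
    evalInt (Bᵀ * B) x = ∑ i, (B *ᵥ fun j => (x j : ℝ)) i ^ 2 := by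
  rw [evalInt, ← Matrix.mulVec_mulVec, Matrix.dotProduct_mulVec, Matrix.vecMul_transpose]
  simp [dotProduct, sq]

theorem cast_mulVec {d : ℕ} (U : Matrix (Fin d) (Fin d) ℤ) (x : Fin d → ℤ) :
    (fun i => (((U *ᵥ x) i : ℤ) : ℝ)) = U.map (Int.cast : ℤ → ℝ) *ᵥ fun i => (x i : ℝ) := by
  ext i
  simp [Matrix.mulVec, dotProduct]

theorem evalInt_conj {d : ℕ} (Q : Matrix (Fin d) (Fin d) ℝ) (U : Matrix (Fin d) (Fin d) ℤ)
    (x : Fin d → ℤ) :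
    evalInt ((U.map (Int.cast : ℤ → ℝ))ᵀ * Q * U.map (Int.cast : ℤ → ℝ)) x =
      evalInt Q (U *ᵥ x) := by
  rw [evalInt, evalInt, cast_mulVec, ← Matrix.mulVec_mulVec, ← Matrix.mulVec_mulVec,
    Matrix.dotProduct_mulVec, Matrix.vecMul_transpose]

/-- The nonzero values of a positive definite form at integral vectors are bounded away
from zero. -/
theorem exists_pos_le_evalInt {d : ℕ} {Q : Matrix (Fin d) (Fin d) ℝ} (hQ : Q.PosDef) :
    ∃ c : ℝ, 0 < c ∧ ∀ x : Fin d → ℤ, x ≠ 0 → c ≤ evalInt Q x := by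
  obtain ⟨B, hB, rfl⟩ := exists_eq_transpose_mul_self hQ
  -- By Cauchy–Schwarz, every coordinate of `x = B⁻¹ (B x)` has square at most `C * Q[x]`, and some
  -- coordinate has square at least `1`.
  set C : ℝ := ∑ i, ∑ j, B⁻¹ i j ^ 2 with hC
  have hC0 : 0 ≤ C := Finset.sum_nonneg fun _ _ => Finset.sum_nonneg fun _ _ => sq_nonneg _
  refine ⟨(C + 1)⁻¹, by positivity, fun x hx => ?_⟩
  obtain ⟨i, hi⟩ := Function.ne_iff.1 hx
  set v := B *ᵥ fun j => (x j : ℝ) with hv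
  have h1 : (x i : ℝ) = ∑ j, B⁻¹ i j * v j := by
    have : B⁻¹ *ᵥ v = fun j => (x j : ℝ) := by
      rw [hv, Matrix.mulVec_mulVec, Matrix.nonsing_inv_mul _ hB, Matrix.one_mulVec]
    exact (congrFun this i).symm
  have h2 : (1 : ℝ) ≤ (x i : ℝ) ^ 2 := by
    have : (1 : ℤ) ≤ x i ^ 2 := Int.one_le_abs (pow_ne_zero 2 hi) |>.trans (by simp)
    exact_mod_cast this
  have h3 : (x i : ℝ) ^ 2 ≤ (∑ j, B⁻¹ i j ^ 2) * ∑ j, v j ^ 2 := by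
    rw [h1]
    exact Finset.sum_mul_sq_le_sq_mul_sq _ _ _
  have h4 : ∑ j, B⁻¹ i j ^ 2 ≤ C :=
    Finset.single_le_sum (f := fun i => ∑ j, B⁻¹ i j ^ 2)
      (fun _ _ => Finset.sum_nonneg fun _ _ => sq_nonneg _) (Finset.mem_univ i)
  rw [evalInt_transpose_mul_self, ← hv, inv_le_iff_one_le_mul₀ (by positivity)]
  have h5 : 0 ≤ ∑ j, v j ^ 2 := Finset.sum_nonneg fun _ _ => sq_nonneg _
  nlinarith [mul_le_mul_of_nonneg_right h4 h5]

/-- Every positive definite form is arithmetically equivalent to one whose short vectors have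
small coordinates. -/
theorem exists_unimodular_sum_sq_le {d : ℕ} {Q : Matrix (Fin d) (Fin d) ℝ} (hQ : Q.PosDef) {l : ℝ}
    (hl : 0 < l) (h : ∀ x : Fin d → ℤ, x ≠ 0 → l ≤ evalInt Q x) :
    ∃ U : GL (Fin d) ℤ, ∀ x : Fin d → ℤ,
      ∑ i, (x i : ℝ) ^ 2 ≤ reductionConst d / l * evalInt Q (U.1 *ᵥ x) := by
  obtain ⟨B, hB, hQB⟩ := exists_eq_transpose_mul_self hQ
  let b : Basis (Fin d) ℝ (EuclideanSpace ℝ (Fin d)) := (Pi.basisFun ℝ (Fin d)).map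
    ((Matrix.toLinearEquiv' B (Matrix.invertibleOfIsUnitDet B hB)).trans
      (WithLp.linearEquiv 2 ℝ (Fin d → ℝ)).symm)
  have hb : ∀ y : Fin d → ℤ, ‖∑ i, (y i : ℝ) • b i‖ ^ 2 = evalInt Q y := fun y => by
    rw [hQB, evalInt_transpose_mul_self, EuclideanSpace.norm_sq_eq]
    refine Finset.sum_congr rfl fun i _ => ?_
    rw [Real.norm_eq_abs, sq_abs]
    congr 1
    have hbi : ∀ j, b j = WithLp.toLp 2 (B.col j) := fun j => by
      simp [b, Matrix.toLinearEquiv']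
    simp [hbi, Matrix.mulVec, dotProduct, mul_comm]
  obtain ⟨b', hspan, hb'⟩ := exists_reduced_basis (Real.sqrt_pos.2 hl) d _ b fun x hx hx0 => by
    obtain ⟨y, rfl⟩ := (mem_span_range_iff_exists_fun ℤ).1 hx
    simp only [← Int.cast_smul_eq_zsmul ℝ] at hx0 ⊢
    refine Real.sqrt_le_iff.2 ⟨norm_nonneg _, ?_⟩
    rw [hb]
    exact h y (by rintro rfl; simp at hx0)
  let bZ := b.restrictScalars ℤ
  let eZ := (b'.restrictScalars ℤ).map (LinearEquiv.ofEq _ _ hspan)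
  refine ⟨⟨bZ.toMatrix eZ, eZ.toMatrix bZ, Basis.toMatrix_mul_toMatrix_flip _ _,
    Basis.toMatrix_mul_toMatrix_flip _ _⟩, fun x => ?_⟩
  set v : span ℤ (Set.range b) := ∑ j, x j • eZ j with hv
  have hxv : ⇑(eZ.repr v) = x := eZ.repr_sum_self x
  have h1 : bZ.toMatrix eZ *ᵥ x = bZ.repr v := by
    rw [← hxv]
    exact Basis.toMatrix_mulVec_repr eZ bZ v
  have h2 : (v : EuclideanSpace ℝ (Fin d)) = ∑ j, (x j : ℝ) • b' j := by
    simp [hv, eZ, Int.cast_smul_eq_zsmul]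
  have h3 : (v : EuclideanSpace ℝ (Fin d)) = ∑ j, (bZ.repr v j : ℝ) • b j := by
    have := congrArg (Submodule.subtype _) (bZ.sum_repr v)
    simp only [map_sum, map_smul, Submodule.subtype_apply] at this
    rw [← this]
    simp [bZ, Int.cast_smul_eq_zsmul]
  have h4 := hb' v
  have h5 : ∀ i, b'.repr (v : EuclideanSpace ℝ (Fin d)) i = x i := fun i => by
    rw [h2, Basis.repr_sum_self]
  simp only [h5] at h4
  rw [Real.sq_sqrt hl.le, h3, hb] at h4
  change _ ≤ _ * evalInt Q (bZ.toMatrix eZ *ᵥ x)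
  rw [h1]
  exact h4

/-! ### Symmetric matrices as a Euclidean space -/

/-- The index set of the coordinates of a symmetric matrix. -/
abbrev SymIndex (d : ℕ) : Type := {p : Fin d × Fin d // p.1 ≤ p.2}

theorem card_symIndex (d : ℕ) : Fintype.card (SymIndex d) = (d + 1).choose 2 := by
  rw [← Fintype.card_congr (Sym2.sortEquiv (α := Fin d)), Sym2.card, Fintype.card_fin]

/-- The weights which turn the Euclidean norm on coordinates into the Frobenius norm. -/
noncomputable def weight {d : ℕ} (p : SymIndex d) : ℝ := if p.1.1 = p.1.2 then 1 else √2

theorem weight_pos {d : ℕ} (p : SymIndex d) : 0 < weight p := by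
  unfold weight; split_ifs <;> positivity

theorem weight_sq {d : ℕ} (p : SymIndex d) : weight p ^ 2 = if p.1.1 = p.1.2 then 1 else 2 := by
  unfold weight; split_ifs <;> simp

theorem sum_weight_sq_mul {d : ℕ} (g : Fin d → Fin d → ℝ) (hg : ∀ i j, g i j = g j i) :
    ∑ p : SymIndex d, weight p ^ 2 * g p.1.1 p.1.2 = ∑ i, ∑ j, g i j := by
  have h1 : ∑ p : SymIndex d, weight p ^ 2 * g p.1.1 p.1.2 =
      ∑ p : Fin d × Fin d with p.1 ≤ p.2, (if p.1 = p.2 then 1 else 2) * g p.1 p.2 := by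
    simp only [weight_sq]
    exact (Finset.sum_subtype _ (by simp) fun p : Fin d × Fin d =>
      (if p.1 = p.2 then 1 else 2) * g p.1 p.2).symm
  have h2 : ∑ p : Fin d × Fin d with ¬ p.1 ≤ p.2, g p.1 p.2 =
      ∑ p : Fin d × Fin d with p.1 < p.2, g p.1 p.2 :=
    Finset.sum_nbij' Prod.swap Prod.swap (by simp) (by simp) (by simp) (by simp)
      (fun p _ => hg _ _)
  have h3 : ∑ p : Fin d × Fin d with p.1 < p.2, g p.1 p.2 =
      ∑ p : Fin d × Fin d with p.1 ≤ p.2, (if p.1 = p.2 then 0 else 1) * g p.1 p.2 := by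
    rw [Finset.sum_filter, Finset.sum_filter]
    refine Finset.sum_congr rfl fun p _ => ?_
    rcases lt_trichotomy p.1 p.2 with h | h | h
    · simp [h, h.le, h.ne]
    · simp [h]
    · simp [h.not_ge, h.not_gt]
  rw [h1, ← Fintype.sum_prod_type' (f := g),
    ← Finset.sum_filter_add_sum_filter_not Finset.univ (fun p : Fin d × Fin d => p.1 ≤ p.2), h2, h3,
    ← Finset.sum_add_distrib]
  refine Finset.sum_congr rfl fun p _ => ?_
  split_ifs <;> ring

/-- The coordinates of the symmetric matrix `x xᵗ`, isometric for the Frobenius norm. -/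
noncomputable def sqVec {d : ℕ} (x : Fin d → ℤ) : SymIndex d → ℝ :=
  fun p => weight p * (x p.1.1 * x p.1.2)

/-- The Frobenius product with a symmetric matrix, as a linear form in the coordinates. -/
noncomputable def pairing {d : ℕ} (S : Matrix (Fin d) (Fin d) ℝ) : (SymIndex d → ℝ) →ₗ[ℝ] ℝ :=
  ∑ p : SymIndex d, (weight p * S p.1.1 p.1.2) • LinearMap.proj p

theorem pairing_apply {d : ℕ} (S : Matrix (Fin d) (Fin d) ℝ) (z : SymIndex d → ℝ) :
    pairing S z = ∑ p, weight p * S p.1.1 p.1.2 * z p := by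
  simp [pairing]

theorem pairing_sqVec {d : ℕ} {S : Matrix (Fin d) (Fin d) ℝ} (hS : S.IsSymm) (x : Fin d → ℤ) :
    pairing S (sqVec x) = evalInt S x := by
  have h := sum_weight_sq_mul (fun i j => (x i : ℝ) * (S i j * x j))
    (fun i j => by rw [hS.apply]; ring)
  rw [pairing_apply]
  simp only [evalInt, Matrix.mulVec, dotProduct, Finset.mul_sum]
  rw [← h]
  exact Finset.sum_congr rfl fun p _ => by simp only [sqVec]; ring

theorem evalInt_one {d : ℕ} (x : Fin d → ℤ) : evalInt 1 x = ∑ i, (x i : ℝ) ^ 2 := by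
  simp [evalInt, dotProduct, sq]

/-- The matrix `x xᵗ` has rank one, so its Frobenius norm equals its trace. This places it on the
boundary of the circular cone used later. -/
theorem norm_sqVec {d : ℕ} (x : Fin d → ℤ) :
    ‖WithLp.toLp 2 (sqVec x)‖ = ∑ i, (x i : ℝ) ^ 2 := by
  have h := sum_weight_sq_mul (fun i j => (x i : ℝ) ^ 2 * (x j : ℝ) ^ 2) (fun i j => by ring)
  have h0 : 0 ≤ ∑ i, (x i : ℝ) ^ 2 := Finset.sum_nonneg fun _ _ => sq_nonneg _
  rw [← sq_eq_sq₀ (norm_nonneg _) h0, EuclideanSpace.norm_sq_eq, sq (∑ i, _), Finset.sum_mul_sum,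
    ← h]
  refine Finset.sum_congr rfl fun p _ => ?_
  rw [Real.norm_eq_abs, sq_abs]
  simp only [sqVec]
  ring

theorem pairing_single {d : ℕ} (S : Matrix (Fin d) (Fin d) ℝ) (p : SymIndex d) :
    pairing S (Pi.single p 1) = weight p * S p.1.1 p.1.2 := by
  simp [pairing_apply, Pi.single_apply]

theorem eq_zero_of_pairing_eq_zero {d : ℕ} {S : Matrix (Fin d) (Fin d) ℝ} (hS : S.IsSymm)
    (h : pairing S = 0) : S = 0 := by
  have h1 : ∀ i j, i ≤ j → S i j = 0 := fun i j hij => by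
    have := pairing_single S ⟨(i, j), hij⟩
    rw [h, LinearMap.zero_apply] at this
    exact (mul_eq_zero.1 this.symm).resolve_left (weight_pos _).ne'
  ext i j
  rcases le_total i j with hij | hij
  · exact h1 i j hij
  · rw [← hS.apply]
    exact h1 j i hij

theorem exists_eq_pairing {d : ℕ} (f : (SymIndex d → ℝ) →ₗ[ℝ] ℝ) :
    ∃ S : Matrix (Fin d) (Fin d) ℝ, S.IsSymm ∧ f = pairing S := by
  let g : SymIndex d → ℝ := fun p => f (Pi.single p 1) / weight p
  refine ⟨Matrix.of fun i j => g ⟨(min i j, max i j), min_le_max⟩, ?_, ?_⟩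
  · ext i j
    simp only [Matrix.transpose_apply, Matrix.of_apply, min_comm, max_comm]
  · refine LinearMap.pi_ext' fun p => LinearMap.ext_ring ?_
    change f (Pi.single p 1) = pairing _ (Pi.single p 1)
    rw [pairing_single]
    have : (⟨(min p.1.1 p.1.2, max p.1.1 p.1.2), min_le_max⟩ : SymIndex d) = p :=
      Subtype.ext (Prod.ext (min_eq_left p.2) (max_eq_right p.2))
    rw [Matrix.of_apply, this, mul_div_cancel₀ _ (weight_pos p).ne']

/-! ### Reduced simplices of perfect forms -/

/-- A positive form together with minimal vectors which determine the form and which have small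
coordinates. -/
structure ReducedSimplex (d : ℕ) where
  /-- the form -/
  form : Matrix (Fin d) (Fin d) ℝ
  /-- the arithmetical minimum -/
  min : ℝ
  /-- the minimal vectors -/
  vec : SymIndex d → Fin d → ℤ
  isSymm : form.IsSymm
  min_pos : 0 < min
  min_le : ∀ x : Fin d → ℤ, x ≠ 0 → min ≤ evalInt form x
  vec_ne_zero : ∀ q, vec q ≠ 0
  eval_vec : ∀ q, evalInt form (vec q) = min
  linearIndependent : LinearIndependent ℝ fun q => sqVec (vec q)
  sum_sq_le : ∀ q, ∑ i, (vec q i : ℝ) ^ 2 ≤ reductionConst d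

theorem arithMin_le {d : ℕ} {Q : Matrix (Fin d) (Fin d) ℝ} (hQ : Q.PosDef) {x : Fin d → ℤ}
    (hx : x ≠ 0) : arithMin Q ≤ evalInt Q x := by
  obtain ⟨c, -, hc⟩ := exists_pos_le_evalInt hQ
  exact csInf_le ⟨c, by rintro _ ⟨y, hy, rfl⟩; exact hc y hy⟩ ⟨x, hx, rfl⟩

theorem arithMin_pos {d : ℕ} (hd : 1 ≤ d) {Q : Matrix (Fin d) (Fin d) ℝ} (hQ : Q.PosDef) :
    0 < arithMin Q := by
  obtain ⟨c, hc0, hc⟩ := exists_pos_le_evalInt hQ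
  refine hc0.trans_le (le_csInf ?_ (by rintro _ ⟨y, hy, rfl⟩; exact hc y hy))
  exact ⟨_, fun _ => 1, fun h => one_ne_zero (congrFun h ⟨0, hd⟩), rfl⟩

theorem evalInt_zero_right {d : ℕ} (Q : Matrix (Fin d) (Fin d) ℝ) : evalInt Q 0 = 0 := by
  simp [evalInt]

theorem evalInt_add {d : ℕ} (Q S : Matrix (Fin d) (Fin d) ℝ) (x : Fin d → ℤ) :
    evalInt (Q + S) x = evalInt Q x + evalInt S x := by
  simp [evalInt, Matrix.add_mulVec]

/-- A linear form vanishing on the span is the pairing with some `S`. Transporting `S` back by `U⁻¹`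
and adding it to `Q` keeps all values at minimal vectors, so perfection forces `S = 0`. -/
theorem IsPerfect.span_sqVec {d : ℕ} {Q : Matrix (Fin d) (Fin d) ℝ} (hQ : IsPerfect Q)
    (U : GL (Fin d) ℤ) :
    span ℝ ((fun x => sqVec ((U⁻¹).1 *ᵥ x)) '' minVectors Q) = ⊤ := by
  by_contra hne
  obtain ⟨f, hf0, hf⟩ := Submodule.exists_le_ker_of_lt_top _ (lt_top_iff_ne_top.2 hne)
  obtain ⟨S, hS, rfl⟩ := exists_eq_pairing f
  set A := U.1.map (Int.cast : ℤ → ℝ) with hA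
  set A' := (U⁻¹).1.map (Int.cast : ℤ → ℝ) with hA'
  have hAA : A' * A = 1 := by
    rw [hA, hA', ← map_cast_mul, Units.inv_mul]
    simp [Matrix.map_one]
  have h0 : A'ᵀ * S * A' = 0 := by
    have hsymm : Qᵀ = Q := by
      simpa [Matrix.IsHermitian, Matrix.conjTranspose_eq_transpose_of_trivial] using hQ.1.isHermitian
    refine add_eq_left.1 (hQ.2 (Q + A'ᵀ * S * A') ?_ fun x hx => ?_)
    · simp [Matrix.IsSymm, Matrix.transpose_mul, Matrix.mul_assoc, hS.eq, hsymm]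
    · have h1 : pairing S (sqVec ((U⁻¹).1 *ᵥ x)) = 0 := hf (subset_span ⟨x, hx, rfl⟩)
      rw [evalInt_add, evalInt_conj, ← pairing_sqVec hS, h1, add_zero]
      exact hx
  have hS0 : S = 0 := by
    calc S = (A' * A)ᵀ * S * (A' * A) := by rw [hAA]; simp
      _ = Aᵀ * (A'ᵀ * S * A') * A := by rw [Matrix.transpose_mul]; simp only [Matrix.mul_assoc]
      _ = 0 := by rw [h0]; simp
  apply hf0
  ext
  simp [hS0, pairing]

/-- Every perfect form is arithmetically equivalent to the form of a reduced simplex. -/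
theorem IsPerfect.exists_reducedSimplex {d : ℕ} (hd : 1 ≤ d) {Q : Matrix (Fin d) (Fin d) ℝ}
    (hQ : IsPerfect Q) : ∃ R : ReducedSimplex d, Similar Q R.form := by
  have hpos := arithMin_pos hd hQ.1
  obtain ⟨U, hU⟩ := exists_unimodular_sum_sq_le hQ.1 hpos fun x hx => arithMin_le hQ.1 hx
  have hinv : ∀ x : Fin d → ℤ, U.1 *ᵥ ((U⁻¹).1 *ᵥ x) = x := fun x => by
    rw [Matrix.mulVec_mulVec, Units.mul_inv, Matrix.one_mulVec]
  have hinv' : ∀ x : Fin d → ℤ, (U⁻¹).1 *ᵥ (U.1 *ᵥ x) = x := fun x => by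
    rw [Matrix.mulVec_mulVec, Units.inv_mul, Matrix.one_mulVec]
  obtain ⟨v, hv, -, hvli⟩ := Submodule.exists_fun_fin_finrank_span_eq ℝ
    ((fun x => sqVec ((U⁻¹).1 *ᵥ x)) '' minVectors Q)
  have hcard : finrank ℝ (span ℝ ((fun x => sqVec ((U⁻¹).1 *ᵥ x)) '' minVectors Q)) =
      Fintype.card (SymIndex d) := by
    rw [hQ.span_sqVec U, finrank_top, finrank_pi]
  let e : SymIndex d ≃ Fin _ := Fintype.equivFinOfCardEq hcard.symm
  choose x hx hxv using hv
  have hne : ∀ q, x q ≠ 0 := fun q h0 => by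
    have : evalInt Q (x q) = arithMin Q := hx q
    rw [h0, evalInt_zero_right] at this
    exact hpos.ne this
  have hsymm : Qᵀ = Q := by
    simpa [Matrix.IsHermitian, Matrix.conjTranspose_eq_transpose_of_trivial] using hQ.1.isHermitian
  refine ⟨⟨(U.1.map (Int.cast : ℤ → ℝ))ᵀ * Q * U.1.map (Int.cast : ℤ → ℝ), arithMin Q,
    fun q => (U⁻¹).1 *ᵥ x (e q), ?_, hpos, fun y hy => ?_, fun q h0 => ?_, fun q => ?_, ?_,
    fun q => ?_⟩, 1, one_pos, U, by simp⟩
  · simp [Matrix.IsSymm, Matrix.transpose_mul, Matrix.mul_assoc, hsymm]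
  · rw [evalInt_conj]
    refine arithMin_le hQ.1 fun h0 => hy ?_
    rw [← hinv' y, h0, Matrix.mulVec_zero]
  · apply hne (e q)
    rw [← hinv (x (e q)), h0, Matrix.mulVec_zero]
  · rw [evalInt_conj, hinv]
    exact hx _
  · have h := hvli.comp e e.injective
    rw [show v ∘ e = fun q => sqVec ((U⁻¹).1 *ᵥ x (e q)) from
      funext fun q => (hxv (e q)).symm] at h
    exact h
  -- At a minimal vector the value of the form cancels the minimum in the denominator, leaving a
  -- constant depending only on `d`.
  · refine (hU _).trans (le_of_eq ?_)
    rw [hinv, show evalInt Q (x (e q)) = arithMin Q from hx _, div_mul_cancel₀ _ hpos.ne']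

/-! ### Disjointness of the simplicial cones -/

namespace ReducedSimplex

variable {d : ℕ}

/-- Pair the common point with `R.form`: the left expansion gives `R.min * ∑ s`, the right one at
least `R.min * ∑ t`. -/
theorem sum_le_sum (R R' : ReducedSimplex d) {s t : SymIndex d → ℝ} (ht : ∀ q, 0 < t q)
    (h : ∑ q, s q • sqVec (R.vec q) = ∑ q, t q • sqVec (R'.vec q)) : ∑ q, t q ≤ ∑ q, s q := by
  have h1 := congrArg (pairing R.form) h
  simp only [map_sum, map_smul, pairing_sqVec R.isSymm, R.eval_vec, smul_eq_mul] at h1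
  have h2 : ∑ q, t q * R.min ≤ ∑ q, t q * evalInt R.form (R'.vec q) :=
    Finset.sum_le_sum fun q _ =>
      mul_le_mul_of_nonneg_left (R.min_le _ (R'.vec_ne_zero q)) (ht q).le
  rw [← h1, ← Finset.sum_mul, ← Finset.sum_mul] at h2
  exact le_of_mul_le_mul_right h2 R.min_pos

/-- If the open simplicial cones of two reduced simplices meet, then the forms are
proportional. -/
theorem similar_of_sum_eq (R R' : ReducedSimplex d) {s t : SymIndex d → ℝ} (hs : ∀ q, 0 < s q)
    (ht : ∀ q, 0 < t q)
    (h : ∑ q, s q • sqVec (R.vec q) = ∑ q, t q • sqVec (R'.vec q)) : Similar R.form R'.form := by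
  have hsum : ∑ q, s q = ∑ q, t q :=
    le_antisymm (sum_le_sum R' R hs h.symm) (sum_le_sum R R' ht h)
  have h1 := congrArg (pairing R.form) h
  simp only [map_sum, map_smul, pairing_sqVec R.isSymm, R.eval_vec, smul_eq_mul] at h1
  -- Equality of the coefficient sums makes this sum of nonnegative terms vanish; as all `t q` are
  -- positive, `R.form` attains its minimum at every vector of `R'`.
  have h2 : ∑ q, t q * (evalInt R.form (R'.vec q) - R.min) = 0 := by
    simp only [mul_sub, Finset.sum_sub_distrib]
    rw [← h1, ← Finset.sum_mul, ← Finset.sum_mul, hsum, sub_self]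
  rw [Finset.sum_eq_zero_iff_of_nonneg fun q _ =>
    mul_nonneg (ht q).le (sub_nonneg.2 (R.min_le _ (R'.vec_ne_zero q)))] at h2
  have h3 : ∀ q, evalInt R.form (R'.vec q) = R.min := fun q =>
    sub_eq_zero.1 ((mul_eq_zero.1 (h2 q (Finset.mem_univ q))).resolve_left (ht q).ne')
  have hspan : span ℝ (Set.range fun q => sqVec (R'.vec q)) = ⊤ :=
    R'.linearIndependent.span_eq_top_of_card_eq_finrank' (by simp)
  have hlin : pairing (R'.min • R.form - R.min • R'.form) = 0 := by
    refine LinearMap.ext_on_range hspan fun q => ?_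
    have : pairing (R'.min • R.form - R.min • R'.form) =
        R'.min • pairing R.form - R.min • pairing R'.form := by
      ext
      simp [pairing_single]
      ring
    rw [this, LinearMap.sub_apply, LinearMap.smul_apply, LinearMap.smul_apply,
      pairing_sqVec R.isSymm, pairing_sqVec R'.isSymm, h3, R'.eval_vec, LinearMap.zero_apply,
      smul_eq_mul, smul_eq_mul]
    ring
  have h4 := eq_zero_of_pairing_eq_zero ((R.isSymm.smul _).sub (R'.isSymm.smul _)) hlin
  refine ⟨R.min / R'.min, div_pos R.min_pos R'.min_pos, 1, ?_⟩
  rw [sub_eq_zero] at h4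
  rw [div_eq_inv_mul, mul_smul, ← h4, smul_smul, inv_mul_cancel₀ R'.min_pos.ne', one_smul]
  simp [Matrix.map_one]

end ReducedSimplex

/-! ### Exponential integrals over cones -/

/-- The integral of `exp (-φ)` over the simplicial cone spanned by the columns of a matrix. -/
theorem lintegral_simplicialCone {ι : Type*} [Fintype ι] [DecidableEq ι] (A : Matrix ι ι ℝ)
    (hA : A.det ≠ 0) (a : ι → ℝ) (ha : ∀ i, 0 < a i) (φ : (ι → ℝ) → ℝ)
    (hφ : ∀ t, φ (A *ᵥ t) = ∑ i, a i * t i) :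
    ∫⁻ z in A.mulVec '' (Set.univ.pi fun _ => Set.Ioi 0), ENNReal.ofReal (Real.exp (-φ z)) =
      ENNReal.ofReal (|A.det| * ∏ i, (a i)⁻¹) := by
  have hinj : Function.Injective A.mulVec :=
    Matrix.mulVec_injective_iff_isUnit.2 ((Matrix.isUnit_iff_isUnit_det _).2 (isUnit_iff_ne_zero.2 hA))
  let T : (ι → ℝ) →L[ℝ] (ι → ℝ) := LinearMap.toContinuousLinearMap (Matrix.toLin' A)
  have hT : T.det = A.det := by
    simp [T, ContinuousLinearMap.det]
  -- The linear change of variables has constant Jacobian and turns the integrand into a product of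
  -- one-variable exponentials.
  rw [lintegral_image_eq_lintegral_abs_det_fderiv_mul volume (f := A.mulVec) (f' := fun _ => T)
    (MeasurableSet.univ_pi fun _ => measurableSet_Ioi)
    (fun x _ => (T.hasFDerivAt (x := x)).hasFDerivWithinAt) hinj.injOn, hT,
    volume_pi, Measure.restrict_pi_pi, lintegral_const_mul' _ _ ENNReal.ofReal_ne_top,
    ENNReal.ofReal_mul (abs_nonneg _)]
  congr 1
  have hexp : ∀ t : ι → ℝ, Real.exp (-φ (A *ᵥ t)) = ∏ i, Real.exp (-a i * t i) := fun t => by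
    rw [hφ, ← Real.exp_sum, ← Finset.sum_neg_distrib]
    simp
  simp only [hexp]
  have hprod : Integrable (fun t : ι → ℝ => ∏ i, Real.exp (-a i * t i))
      (Measure.pi fun _ : ι => volume.restrict (Set.Ioi (0 : ℝ))) :=
    Integrable.fintype_prod (f := fun i s => Real.exp (-a i * s)) fun i =>
      integrableOn_exp_mul_Ioi (neg_neg_of_pos (ha i)) 0
  rw [← ofReal_integral_eq_lintegral_ofReal hprod
    (Filter.Eventually.of_forall fun t => Finset.prod_nonneg fun i _ => (Real.exp_pos _).le),
    integral_fintype_prod_eq_prod (fun i s => Real.exp (-a i * s))]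
  congr 1
  refine Finset.prod_congr rfl fun i _ => ?_
  rw [integral_exp_mul_Ioi (neg_neg_of_pos (ha i))]
  simp [neg_div_neg_eq]

theorem lintegral_pow_mul_exp_neg (m : ℕ) {r : ℝ} (hr : 0 < r) :
    ∫⁻ s in Set.Ioi (0 : ℝ), ENNReal.ofReal (s ^ m * Real.exp (-(r * s))) =
      ENNReal.ofReal (m.factorial / r ^ (m + 1)) := by
  have h := Real.integral_rpow_mul_exp_neg_mul_Ioi (a := m + 1) (r := r) (by positivity) hr
  simp only [add_sub_cancel_right, Real.rpow_natCast, Real.Gamma_nat_eq_factorial] at h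
  rw [← Nat.cast_succ, Real.rpow_natCast, one_div, inv_pow, inv_mul_eq_div] at h
  rw [← h, ofReal_integral_eq_lintegral_ofReal]
  -- Integrability comes for free: the integral of a non-integrable function is `0` by convention,
  -- but this value is positive.
  · by_contra hcon
    rw [integral_undef hcon] at h
    have : 0 < (m.factorial : ℝ) / r ^ (m + 1) := by positivity
    exact this.ne h
  · filter_upwards [ae_restrict_mem measurableSet_Ioi] with s hs
    have : (0 : ℝ) < s := hs
    positivity

/-- An orthonormal splitting of Euclidean space along a unit vector preserves volume. -/
theorem exists_measurePreserving_split {ι : Type*} [Fintype ι] {m : ℕ}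
    (hι : Fintype.card ι = m + 1) (u : EuclideanSpace ℝ ι) (hu : ‖u‖ = 1) :
    ∃ Ψ : EuclideanSpace ℝ ι → ℝ × EuclideanSpace ℝ (Fin m), MeasurePreserving Ψ ∧
      ∀ z, (Ψ z).1 = inner ℝ u z ∧ ‖z‖ ^ 2 = (Ψ z).1 ^ 2 + ‖(Ψ z).2‖ ^ 2 := by
  obtain ⟨o, ho⟩ := Orthonormal.exists_orthonormalBasis_extension_of_card_eq
    (𝕜 := ℝ) (E := EuclideanSpace ℝ ι) (ι := Fin (m + 1)) (by simp [hι]) (v := fun _ => u) (s := {0})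
    (by
      rw [orthonormal_subsingleton_iff]
      exact fun _ => hu)
  have ho0 : o 0 = u := ho 0 rfl
  refine ⟨fun z => Prod.map id (WithLp.toLp 2)
    (MeasurableEquiv.piFinSuccAbove (fun _ : Fin (m + 1) => ℝ) 0 (WithLp.ofLp (o.repr z))), ?_,
    fun z => ⟨?_, ?_⟩⟩
  · exact ((MeasurePreserving.id volume).prod (PiLp.volume_preserving_toLp (Fin m))).comp
      ((volume_preserving_piFinSuccAbove (fun _ : Fin (m + 1) => ℝ) 0).comp
        ((PiLp.volume_preserving_ofLp (Fin (m + 1))).comp o.measurePreserving_repr))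
  · change o.repr z 0 = _
    rw [o.repr_apply_apply, ho0]
  · rw [← o.repr.norm_map, EuclideanSpace.norm_sq_eq, EuclideanSpace.norm_sq_eq,
      Fin.sum_univ_succ]
    simp [MeasurableEquiv.piFinSuccAbove, Fin.tail]

/-- The integral of `exp (-r ⟪u, z⟫)` over a circular cone with axis `u`. -/
theorem lintegral_circularCone_le {ι : Type*} [Fintype ι] {m : ℕ} (hm : 0 < m)
    (hι : Fintype.card ι = m + 1) (u : EuclideanSpace ℝ ι) (hu : ‖u‖ = 1) {r : ℝ} (hr : 1 ≤ r)
    (S : Set (EuclideanSpace ℝ ι)) (hSm : MeasurableSet S)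
    (hS : ∀ z ∈ S, 0 < inner ℝ u z ∧ ‖z‖ ≤ r * inner ℝ u z) :
    ∫⁻ z in S, ENNReal.ofReal (Real.exp (-(r * inner ℝ u z))) ≤
      ENNReal.ofReal (√Real.pi ^ m / Real.Gamma (m / 2 + 1) * √(r ^ 2 - 1) ^ m *
        (m.factorial / r ^ (m + 1))) := by
  obtain ⟨Ψ, hΨ, hΨz⟩ := exists_measurePreserving_split hι u hu
  have : Nonempty (Fin m) := ⟨⟨0, hm⟩⟩
  have hr0 : 0 ≤ r ^ 2 - 1 := by nlinarith
  have hr0' : 0 < r := by linarith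
  let K : Set (ℝ × EuclideanSpace ℝ (Fin m)) := {q | 0 < q.1 ∧ ‖q.2‖ ≤ √(r ^ 2 - 1) * q.1}
  have hK : MeasurableSet K :=
    (measurableSet_lt measurable_const measurable_fst).inter
      (measurableSet_le measurable_snd.norm (measurable_const.mul measurable_fst))
  let G : ℝ × EuclideanSpace ℝ (Fin m) → ENNReal :=
    K.indicator fun q => ENNReal.ofReal (Real.exp (-(r * q.1)))
  have hG : Measurable G := Measurable.indicator (by fun_prop) hK
  calc ∫⁻ z in S, ENNReal.ofReal (Real.exp (-(r * inner ℝ u z)))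
      ≤ ∫⁻ z, G (Ψ z) := by
        rw [← lintegral_indicator hSm]
        refine lintegral_mono fun z => ?_
        by_cases hz : z ∈ S
        · obtain ⟨h1, h2⟩ := hS z hz
          obtain ⟨h3, h4⟩ := hΨz z
          have hzK : Ψ z ∈ K := by
            rw [← h3] at h1 h2
            -- By Pythagoras, `‖z‖ ≤ r s` says that the slice at height `s` lies in a ball of radius
            -- `√(r² - 1) s`.
            refine ⟨h1, abs_le_of_sq_le_sq' ?_ (by positivity) |>.2⟩
            rw [mul_pow, Real.sq_sqrt hr0]
            have := pow_le_pow_left₀ (norm_nonneg z) h2 2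
            nlinarith
          simp only [G, Set.indicator_of_mem hz, Set.indicator_of_mem hzK, h3, le_refl]
        · simp [Set.indicator_of_notMem hz]
    _ = ∫⁻ q, G q := hΨ.lintegral_comp hG
    _ = ∫⁻ s, ∫⁻ w, G (s, w) := lintegral_prod _ hG.aemeasurable
    _ = ∫⁻ s, (Set.Ioi (0 : ℝ)).indicator (fun s =>
          ENNReal.ofReal (√Real.pi ^ m / Real.Gamma (m / 2 + 1) * √(r ^ 2 - 1) ^ m) *
            ENNReal.ofReal (s ^ m * Real.exp (-(r * s)))) s := by
        refine lintegral_congr fun s => ?_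
        by_cases hs : s ∈ Set.Ioi (0 : ℝ)
        · have hs0 : 0 < s := hs
          rw [Set.indicator_of_mem hs]
          have h1 : ∀ w, G (s, w) = (Metric.closedBall (0 : EuclideanSpace ℝ (Fin m))
              (√(r ^ 2 - 1) * s)).indicator (fun _ => ENNReal.ofReal (Real.exp (-(r * s)))) w := by
            intro w
            by_cases hw : ‖w‖ ≤ √(r ^ 2 - 1) * s
            · rw [Set.indicator_of_mem (by simpa using hw)]
              have hsw : (s, w) ∈ K := ⟨hs0, hw⟩
              simp only [G, Set.indicator_of_mem hsw]
            · rw [Set.indicator_of_notMem (by simpa using hw)]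
              exact Set.indicator_of_notMem (fun h : (s, w) ∈ K => hw h.2) _
          simp only [h1]
          rw [lintegral_indicator_const Metric.isClosed_closedBall.measurableSet,
            EuclideanSpace.volume_closedBall, Fintype.card_fin,
            ← ENNReal.ofReal_pow (mul_nonneg (Real.sqrt_nonneg _) hs0.le),
            ← ENNReal.ofReal_mul (pow_nonneg (mul_nonneg (Real.sqrt_nonneg _) hs0.le) m),
            ← ENNReal.ofReal_mul (Real.exp_pos _).le, ← ENNReal.ofReal_mul (by positivity)]
          congr 1
          ring
        · rw [Set.indicator_of_notMem hs]
          have h1 : ∀ w, G (s, w) = 0 := fun w =>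
            Set.indicator_of_notMem (fun h : (s, w) ∈ K => hs h.1) _
          simp [h1]
    _ = _ := by
        rw [lintegral_indicator measurableSet_Ioi, lintegral_const_mul' _ _ ENNReal.ofReal_ne_top,
          lintegral_pow_mul_exp_neg m hr0', ← ENNReal.ofReal_mul (by positivity)]

/-! ### Mass of the simplicial cones -/

theorem card_diag_symIndex (d : ℕ) :
    (Finset.univ.filter fun p : SymIndex d => p.1.1 = p.1.2).card = d := by
  conv_rhs => rw [← Fintype.card_fin d, ← Finset.card_univ]
  refine Finset.card_nbij' (fun p => p.1.1) (fun i => ⟨(i, i), le_rfl⟩) (by simp) (by simp) ?_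
    fun _ _ => rfl
  intro p hp
  exact Subtype.ext (Prod.ext rfl (Finset.mem_filter.1 hp).2)

theorem prod_weight (d : ℕ) : ∏ p : SymIndex d, weight p = √2 ^ ((d + 1).choose 2 - d) := by
  have h := Finset.card_filter_add_card_filter_not (s := (Finset.univ : Finset (SymIndex d)))
    (fun p => p.1.1 = p.1.2)
  rw [card_diag_symIndex, Finset.card_univ, card_symIndex] at h
  simp only [weight]
  rw [Finset.prod_ite, Finset.prod_const_one, one_mul, Finset.prod_const]
  congr 1
  omega

/-- The unit vector in the direction of the identity matrix. -/
noncomputable def axis (d : ℕ) : EuclideanSpace ℝ (SymIndex d) :=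
  WithLp.toLp 2 fun p => if p.1.1 = p.1.2 then (√d)⁻¹ else 0

theorem norm_axis {d : ℕ} (hd : 1 ≤ d) : ‖axis d‖ = 1 := by
  have hd0 : (0 : ℝ) < d := by exact_mod_cast hd
  rw [← sq_eq_sq₀ (norm_nonneg _) zero_le_one, EuclideanSpace.norm_sq_eq]
  simp only [axis, Real.norm_eq_abs, sq_abs, ite_pow, inv_pow, Real.sq_sqrt hd0.le]
  rw [Finset.sum_ite, Finset.sum_const, card_diag_symIndex]
  simp [hd0.ne']

theorem sqrt_mul_inner_axis {d : ℕ} (hd : 1 ≤ d) (z : EuclideanSpace ℝ (SymIndex d)) :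
    √d * inner ℝ (axis d) z = pairing 1 z.ofLp := by
  have hd0 : (0 : ℝ) < √d := Real.sqrt_pos.2 (by exact_mod_cast hd)
  rw [pairing_apply, PiLp.inner_apply, Finset.mul_sum]
  refine Finset.sum_congr rfl fun p _ => ?_
  by_cases hp : p.1.1 = p.1.2
  · simp [axis, weight, Matrix.one_apply, hp]
    field_simp
  · simp [axis, hp]

namespace ReducedSimplex

variable {d : ℕ} (R : ReducedSimplex d)

/-- The matrix whose columns are the generators of the simplicial cone. -/
noncomputable def mat : Matrix (SymIndex d) (SymIndex d) ℝ :=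
  Matrix.of fun p q => sqVec (R.vec q) p

/-- The open simplicial cone. -/
def cone : Set (SymIndex d → ℝ) := R.mat.mulVec '' (Set.univ.pi fun _ => Set.Ioi 0)

theorem mat_mulVec (t : SymIndex d → ℝ) : R.mat *ᵥ t = ∑ q, t q • sqVec (R.vec q) := by
  ext p
  simp [mat, Matrix.mulVec, dotProduct, mul_comm]

theorem det_mat_ne_zero : R.mat.det ≠ 0 := by
  rw [← Matrix.det_transpose, ← isUnit_iff_ne_zero, ← Matrix.isUnit_iff_isUnit_det,
    ← Matrix.linearIndependent_rows_iff_isUnit]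
  exact R.linearIndependent

/-- Pulling the weights out of the rows leaves a nonzero integer determinant; each of the `n - d`
off-diagonal coordinates contributes a factor `√2`. -/
theorem le_abs_det_mat : √2 ^ ((d + 1).choose 2 - d) ≤ |R.mat.det| := by
  let N : Matrix (SymIndex d) (SymIndex d) ℤ :=
    Matrix.of fun p q => R.vec q p.1.1 * R.vec q p.1.2
  have h : R.mat = Matrix.diagonal weight * N.map (Int.castRingHom ℝ) := by
    ext p q
    simp [mat, N, Matrix.diagonal_mul, sqVec]
  have h2 : R.mat.det = (∏ p : SymIndex d, weight p) * (N.det : ℝ) := by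
    rw [h, Matrix.det_mul, Matrix.det_diagonal, ← RingHom.mapMatrix_apply, ← RingHom.map_det]
    rfl
  have hN : N.det ≠ 0 := by
    intro h0
    apply R.det_mat_ne_zero
    rw [h2, h0, Int.cast_zero, mul_zero]
  have h3 : (1 : ℝ) ≤ |(N.det : ℝ)| := by exact_mod_cast Int.one_le_abs hN
  rw [h2, prod_weight, abs_mul, abs_of_nonneg (by positivity)]
  exact le_mul_of_one_le_right (by positivity) h3

theorem sum_sq_pos (q : SymIndex d) : 0 < ∑ i, (R.vec q i : ℝ) ^ 2 := by
  obtain ⟨i, hi⟩ := Function.ne_iff.1 (R.vec_ne_zero q)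
  refine Finset.sum_pos' (fun _ _ => sq_nonneg _) ⟨i, Finset.mem_univ i, ?_⟩
  have : (R.vec q i : ℝ) ≠ 0 := by exact_mod_cast hi
  positivity

theorem pairing_one_mat (t : SymIndex d → ℝ) :
    pairing 1 (R.mat *ᵥ t) = ∑ q, (∑ i, (R.vec q i : ℝ) ^ 2) * t q := by
  rw [mat_mulVec]
  simp only [map_sum, map_smul, pairing_sqVec Matrix.isSymm_one, evalInt_one, smul_eq_mul, mul_comm]

theorem measurableSet_cone : MeasurableSet R.cone := by
  refine MeasurableSet.image_of_continuousOn_injOn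
    (MeasurableSet.univ_pi fun _ => measurableSet_Ioi) ?_ ?_
  · exact (Continuous.matrix_mulVec continuous_const continuous_id).continuousOn
  · exact (Matrix.mulVec_injective_iff_isUnit.2
      ((Matrix.isUnit_iff_isUnit_det _).2 (isUnit_iff_ne_zero.2 R.det_mat_ne_zero))).injOn

theorem le_lintegral_cone {B : ℝ} (hB : reductionConst d ≤ B) :
    ENNReal.ofReal (√2 ^ ((d + 1).choose 2 - d) * (B⁻¹) ^ (d + 1).choose 2) ≤
      ∫⁻ z in R.cone, ENNReal.ofReal (Real.exp (-pairing 1 z)) := by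
  rw [cone, lintegral_simplicialCone R.mat R.det_mat_ne_zero _ R.sum_sq_pos _ R.pairing_one_mat]
  refine ENNReal.ofReal_le_ofReal (mul_le_mul R.le_abs_det_mat ?_ ?_ (abs_nonneg _))
  · rw [← card_symIndex, ← Finset.card_univ, ← Finset.prod_const]
    have hq : ∀ q, ∑ i, (R.vec q i : ℝ) ^ 2 ≤ B := fun q => (R.sum_sq_le q).trans hB
    exact Finset.prod_le_prod
      (fun q _ => inv_nonneg.2 ((R.sum_sq_pos q).le.trans (hq q)))
      fun q _ => inv_anti₀ (R.sum_sq_pos q) (hq q)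
  · have : 0 ≤ B := (reductionConst_nonneg d).trans hB
    positivity

/-- Norm and trace agree on each generator, and the triangle inequality extends this to positive
combinations. -/
theorem mem_cone_circular (hd : 1 ≤ d) {z : SymIndex d → ℝ} (hz : z ∈ R.cone) :
    0 < pairing 1 z ∧ ‖WithLp.toLp 2 z‖ ≤ pairing 1 z := by
  obtain ⟨t, ht, rfl⟩ := hz
  have ht' : ∀ q, 0 < t q := fun q => ht q (Set.mem_univ q)
  rw [pairing_one_mat]
  have : Nonempty (SymIndex d) := ⟨⟨(⟨0, hd⟩, ⟨0, hd⟩), le_rfl⟩⟩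
  refine ⟨Finset.sum_pos (fun q _ => mul_pos (R.sum_sq_pos q) (ht' q)) Finset.univ_nonempty, ?_⟩
  rw [mat_mulVec, WithLp.toLp_sum]
  refine (norm_sum_le _ _).trans (Finset.sum_le_sum fun q _ => ?_)
  rw [WithLp.toLp_smul, norm_smul, norm_sqVec, Real.norm_of_nonneg (ht' q).le, mul_comm]

end ReducedSimplex

/-! ### Volume comparison -/

/-- A finite family of reduced simplices with pairwise non-similar forms is bounded in size by
comparing volumes. -/
theorem card_mul_le_of_pairwise_not_similar {d m : ℕ} (hd : 1 ≤ d) (hm : 0 < m)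
    (hn : (d + 1).choose 2 = m + 1) {κ : Type*} (F : Finset κ) (R : κ → ReducedSimplex d)
    (hR : ∀ c c', Similar (R c).form (R c').form → c = c') {B : ℝ} (hB : reductionConst d ≤ B) :
    (F.card : ℝ) * (√2 ^ (m + 1 - d) * (B⁻¹) ^ (m + 1)) ≤
      √Real.pi ^ m / Real.Gamma (m / 2 + 1) * √((d : ℝ) - 1) ^ m *
        (m.factorial / √(d : ℝ) ^ (m + 1)) := by
  have hd1 : (1 : ℝ) ≤ d := by exact_mod_cast hd
  have hB0 : 0 ≤ B := (reductionConst_nonneg d).trans hB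
  set C := ⋃ c ∈ F, (R c).cone with hC
  have hCm : MeasurableSet C := F.measurableSet_biUnion fun c _ => (R c).measurableSet_cone
  have hexp : Measurable fun z : SymIndex d → ℝ => ENNReal.ofReal (Real.exp (-pairing 1 z)) := by
    have : Continuous (pairing (1 : Matrix (Fin d) (Fin d) ℝ)) :=
      LinearMap.continuous_of_finiteDimensional _
    exact (Real.continuous_exp.comp this.neg).measurable.ennreal_ofReal
  have hlow : ENNReal.ofReal ((F.card : ℝ) * (√2 ^ (m + 1 - d) * (B⁻¹) ^ (m + 1))) ≤
      ∫⁻ z in C, ENNReal.ofReal (Real.exp (-pairing 1 z)) := by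
    rw [hC, lintegral_biUnion_finset ?_ fun c _ => (R c).measurableSet_cone]
    · rw [ENNReal.ofReal_mul (Nat.cast_nonneg _), ENNReal.ofReal_natCast, ← nsmul_eq_mul,
        ← Finset.sum_const]
      refine Finset.sum_le_sum fun c _ => ?_
      rw [← hn]
      exact (R c).le_lintegral_cone hB
    · intro c _ c' _ hcc
      refine Set.disjoint_left.2 ?_
      rintro _ ⟨s, hs, rfl⟩ ⟨t, ht, hts⟩
      refine hcc (hR c c' ((R c).similar_of_sum_eq (R c') (fun q => hs q (Set.mem_univ q))
        (fun q => ht q (Set.mem_univ q)) ?_))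
      rw [← ReducedSimplex.mat_mulVec, ← ReducedSimplex.mat_mulVec]
      exact hts.symm
  -- The value `r = √d` is the Frobenius norm of the identity, so `r ⟪u, z⟫` is the trace.
  have hup := lintegral_circularCone_le hm ((card_symIndex d).trans hn) (axis d) (norm_axis hd)
    (r := √d) (Real.one_le_sqrt.2 hd1) (WithLp.ofLp ⁻¹' C)
    ((PiLp.volume_preserving_ofLp (SymIndex d)).measurable hCm) (fun z hz => by
      simp only [hC, Set.mem_preimage, Set.mem_iUnion] at hz
      obtain ⟨c, -, hz⟩ := hz
      obtain ⟨h1, h2⟩ := (R c).mem_cone_circular hd hz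
      rw [← sqrt_mul_inner_axis hd] at h1 h2
      exact ⟨pos_of_mul_pos_right h1 (Real.sqrt_nonneg _), h2⟩)
  simp only [sqrt_mul_inner_axis hd] at hup
  rw [(PiLp.volume_preserving_ofLp (SymIndex d)).setLIntegral_comp_preimage hCm hexp,
    Real.sq_sqrt (zero_le_one.trans hd1)] at hup
  have hG : 0 < Real.Gamma ((m : ℝ) / 2 + 1) := Real.Gamma_pos_of_pos (by positivity)
  exact (ENNReal.ofReal_le_ofReal_iff (by positivity)).1 (hlow.trans hup)

/-- This yields finiteness as well, and guards against `Nat.card` being `0` on infinite types. -/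
theorem finite_and_natCard_le_of_forall_finset {α : Type*} {X : ℝ}
    (h : ∀ F : Finset α, (F.card : ℝ) ≤ X) : Finite α ∧ (Nat.card α : ℝ) ≤ X := by
  have hfin : Finite α := by
    by_contra hinf
    rw [not_finite_iff_infinite] at hinf
    obtain ⟨F, hF⟩ := Infinite.exists_subset_card_eq α (⌊X⌋₊ + 1)
    have h1 := h F
    rw [hF] at h1
    have h2 := Nat.lt_floor_add_one X
    push_cast at h1
    linarith
  refine ⟨hfin, ?_⟩
  have := Fintype.ofFinite α
  rw [Nat.card_eq_fintype_card]
  exact h Finset.univ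

/-! ### The explicit bound -/

/-- The explicit upper bound in the main theorem. -/
noncomputable def explicitBound (d n : ℕ) : ℝ :=
  ((n - 1).factorial : ℝ) / Real.Gamma ((n : ℝ) / 2 + 1 / 2) *
    Real.sqrt (Real.pi ^ (n - 1) / 2 ^ (7 * n - d) *
      (((d : ℝ) - 1) ^ (n - 1) / (d : ℝ) ^ n)) *
    ((d : ℝ) ^ 3 * ((d : ℝ) + 7)) ^ n

theorem sqrt_pow_of_nonneg {x : ℝ} (hx : 0 ≤ x) (k : ℕ) : √(x ^ k) = √x ^ k := by
  rw [Real.sqrt_eq_iff_mul_self_eq (by positivity) (by positivity), ← mul_pow,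
    Real.mul_self_sqrt hx]

theorem explicitBound_mul {d m : ℕ} (hd : 1 ≤ d) (hdm : d ≤ m + 1) :
    explicitBound d (m + 1) *
        (√2 ^ (m + 1 - d) * (((d : ℝ) ^ 3 * ((d : ℝ) + 7) / 8)⁻¹) ^ (m + 1)) =
      √Real.pi ^ m / Real.Gamma (m / 2 + 1) * √((d : ℝ) - 1) ^ m *
        (m.factorial / √(d : ℝ) ^ (m + 1)) := by
  have hd1 : (1 : ℝ) ≤ d := by exact_mod_cast hd
  have hd0 : (0 : ℝ) < d := by linarith
  -- The exponent `7n - d` merges `n - d` from the determinant with `6n` from the denominator `8` of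
  -- the reduction bound.
  have h8 : √(2 ^ (7 * (m + 1) - d)) = √2 ^ (m + 1 - d) * 8 ^ (m + 1) := by
    rw [sqrt_pow_of_nonneg (by norm_num), show 7 * (m + 1) - d = (m + 1 - d) + 2 * (3 * (m + 1)) by omega,
      pow_add, pow_mul √2 2, Real.sq_sqrt (by norm_num), pow_mul]
    norm_num
  have hsqrt : √(Real.pi ^ m / 2 ^ (7 * (m + 1) - d) * (((d : ℝ) - 1) ^ m / (d : ℝ) ^ (m + 1))) =
      √Real.pi ^ m / (√2 ^ (m + 1 - d) * 8 ^ (m + 1)) *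
        (√((d : ℝ) - 1) ^ m / √(d : ℝ) ^ (m + 1)) := by
    have h0 : 0 ≤ ((d : ℝ) - 1) ^ m := pow_nonneg (by linarith) m
    rw [Real.sqrt_mul (by positivity), Real.sqrt_div (by positivity), Real.sqrt_div h0, h8,
      sqrt_pow_of_nonneg Real.pi_pos.le, sqrt_pow_of_nonneg (by linarith), sqrt_pow_of_nonneg hd0.le]
  have hG : ((m + 1 : ℕ) : ℝ) / 2 + 1 / 2 = (m : ℝ) / 2 + 1 := by push_cast; ring
  have hG0 : Real.Gamma ((m : ℝ) / 2 + 1) ≠ 0 := (Real.Gamma_pos_of_pos (by positivity)).ne'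
  have hX : ((d : ℝ) ^ 3 * ((d : ℝ) + 7)) ^ (m + 1) ≠ 0 := by positivity
  have hE : √(d : ℝ) ^ (m + 1) ≠ 0 := by positivity
  rw [explicitBound, hG, Nat.add_sub_cancel, hsqrt, inv_div, div_pow]
  generalize ((d : ℝ) ^ 3 * ((d : ℝ) + 7)) ^ (m + 1) = X at *
  generalize √(d : ℝ) ^ (m + 1) = E at *
  generalize √((d : ℝ) - 1) ^ m = Y
  field_simp

theorem le_choose_two {d : ℕ} : d ≤ (d + 1).choose 2 := by
  rw [Nat.choose_succ_succ' d 1, Nat.choose_one_right]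
  exact Nat.le_add_right _ _

theorem numPerfect_le_of_two_le {d : ℕ} (hd : 2 ≤ d) :
    Finite (PerfectClass d) ∧ (numPerfect d : ℝ) ≤ explicitBound d ((d + 1).choose 2) := by
  obtain ⟨m, hm⟩ : ∃ m, (d + 1).choose 2 = m + 1 :=
    ⟨(d + 1).choose 2 - 1, by have := le_choose_two (d := d); omega⟩
  have hdm : d ≤ m + 1 := hm ▸ le_choose_two
  have hd1 : 1 ≤ d := by omega
  have h := fun c : PerfectClass d => c.out.2.exists_reducedSimplex hd1
  choose R hR using h
  refine finite_and_natCard_le_of_forall_finset fun F => ?_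
  have hd0 : (0 : ℝ) < d := by exact_mod_cast hd1
  have key := card_mul_le_of_pairwise_not_similar hd1 (by omega) hm F R
    (fun c c' hcc => by
      rw [← Quotient.out_eq c, ← Quotient.out_eq c']
      exact Quotient.sound (((hR c).trans hcc).trans (hR c').symm))
    (reductionConst_le d hd1)
  rw [← explicitBound_mul hd1 hdm, ← hm] at key
  exact le_of_mul_le_mul_right key (by positivity)

/-! ### One variable, and the asymptotic bound -/

theorem similar_of_posDef_one {Q Q' : Matrix (Fin 1) (Fin 1) ℝ} (hQ : Q.PosDef)
    (hQ' : Q'.PosDef) : Similar Q Q' := by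
  have h : 0 < Q 0 0 := hQ.diag_pos
  have h' : 0 < Q' 0 0 := hQ'.diag_pos
  refine ⟨Q 0 0 / Q' 0 0, div_pos h h', 1, ?_⟩
  ext i j
  fin_cases i
  fin_cases j
  simp [Matrix.map_one, h'.ne']

instance : Subsingleton (PerfectClass 1) :=
  ⟨fun c c' => by
    rw [← Quotient.out_eq c, ← Quotient.out_eq c']
    exact Quotient.sound (similar_of_posDef_one c.out.2.1 c'.out.2.1)⟩

theorem explicitBound_one : explicitBound 1 1 = 1 := by
  norm_num [explicitBound, Real.Gamma_one]

theorem numPerfect_one_le : (numPerfect 1 : ℝ) ≤ 1 := by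
  exact_mod_cast Finite.card_le_one_iff_subsingleton.2 inferInstance

theorem finite_and_numPerfect_le {d : ℕ} (hd : 1 ≤ d) :
    Finite (PerfectClass d) ∧ (numPerfect d : ℝ) ≤ explicitBound d ((d + 1).choose 2) := by
  rcases hd.eq_or_lt with rfl | hd
  · refine ⟨inferInstance, ?_⟩
    exact numPerfect_one_le.trans explicitBound_one.ge
  · exact numPerfect_le_of_two_le hd

/-- With `n ≤ d²`, the factorial costs `d^(2n)` and, since `d + 7 ≤ d⁴`, the last factor costs
`d^(7n)`; the Gamma and square root factors only help. -/
theorem explicitBound_le {d : ℕ} (hd : 2 ≤ d) :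
    explicitBound d ((d + 1).choose 2) ≤ (d : ℝ) ^ (9 * d ^ 2) := by
  have hd2 : (2 : ℝ) ≤ d := by exact_mod_cast hd
  set n := (d + 1).choose 2 with hn
  have hn1 : d + 1 ≤ n := by
    rw [hn, Nat.choose_succ_succ' d 1, Nat.choose_one_right]
    have : 0 < d.choose 2 := Nat.choose_pos hd
    change d + 1 ≤ d + d.choose 2
    omega
  have hn2 : n ≤ d ^ 2 := by
    rw [hn, Nat.choose_two_right, Nat.add_sub_cancel]
    refine Nat.div_le_of_le_mul ?_
    nlinarith
  have hn3 : (3 : ℝ) ≤ n := by exact_mod_cast (by omega : 3 ≤ n)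
  -- Here `n ≥ 3` puts the argument in `[2, ∞)`, where Gamma increases from `Γ(2) = 1`.
  have hG : 1 ≤ Real.Gamma ((n : ℝ) / 2 + 1 / 2) := by
    refine Real.Gamma_two.ge.trans ?_
    exact Real.Gamma_strictMonoOn_Ici.monotoneOn (Set.mem_Ici.2 le_rfl)
      (Set.mem_Ici.2 (by linarith)) (by linarith)
  have h1 : ((n - 1).factorial : ℝ) / Real.Gamma ((n : ℝ) / 2 + 1 / 2) ≤ (d : ℝ) ^ (2 * n) := by
    refine (div_le_self (by positivity) hG).trans ?_
    have h2 : (n - 1).factorial ≤ n ^ n :=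
      (Nat.factorial_le (Nat.sub_le n 1)).trans (Nat.factorial_le_pow n)
    have h3 : n ^ n ≤ d ^ (2 * n) := by
      rw [pow_mul]
      exact Nat.pow_le_pow_left hn2 n
    exact_mod_cast h2.trans h3
  have h2 : √(Real.pi ^ (n - 1) / 2 ^ (7 * n - d) * (((d : ℝ) - 1) ^ (n - 1) / (d : ℝ) ^ n)) ≤ 1 := by
    rw [Real.sqrt_le_one]
    have hpi : Real.pi ^ (n - 1) ≤ (2 : ℝ) ^ (7 * n - d) := by
      calc Real.pi ^ (n - 1) ≤ (2 ^ 2) ^ (n - 1) :=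
            pow_le_pow_left₀ Real.pi_pos.le (by linarith [Real.pi_le_four]) _
        _ = 2 ^ (2 * (n - 1)) := by rw [pow_mul]
        _ ≤ 2 ^ (7 * n - d) := pow_le_pow_right₀ (by norm_num) (by omega)
    have hdd : ((d : ℝ) - 1) ^ (n - 1) ≤ (d : ℝ) ^ n :=
      (pow_le_pow_left₀ (by linarith) (by linarith) _).trans
        (pow_le_pow_right₀ (by linarith) (Nat.sub_le n 1))
    exact mul_le_one₀ (div_le_one_of_le₀ hpi (by positivity))
      (div_nonneg (pow_nonneg (by linarith) _) (by positivity))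
      (div_le_one_of_le₀ hdd (by positivity))
  have h3 : ((d : ℝ) ^ 3 * ((d : ℝ) + 7)) ^ n ≤ (d : ℝ) ^ (7 * n) := by
    rw [pow_mul]
    refine pow_le_pow_left₀ (by positivity) ?_ n
    rw [pow_add (d : ℝ) 3 4]
    gcongr
    nlinarith [pow_le_pow_left₀ (by norm_num) hd2 3]
  calc explicitBound d n ≤ (d : ℝ) ^ (2 * n) * 1 * (d : ℝ) ^ (7 * n) := by
        unfold explicitBound
        gcongr
    _ = (d : ℝ) ^ (9 * n) := by rw [mul_one, ← pow_add]; congr 1; ring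
    _ ≤ (d : ℝ) ^ (9 * d ^ 2) := pow_le_pow_right₀ (by linarith) (by omega)

end PerfectForms

theorem mainTheorem1 :
    (∃ C : ℝ, ∀ d : ℕ, 1 ≤ d →
      (PerfectForms.numPerfect d : ℝ) ≤ Real.exp (C * ((d : ℝ) ^ 2 * Real.log d))) ∧
    ∀ d n : ℕ, 1 ≤ d → n = Nat.choose (d + 1) 2 →
      Finite (PerfectForms.PerfectClass d) ∧
      (PerfectForms.numPerfect d : ℝ) ≤
        ((n - 1).factorial : ℝ) / Real.Gamma ((n : ℝ) / 2 + 1 / 2) *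
          Real.sqrt (Real.pi ^ (n - 1) / 2 ^ (7 * n - d) *
            (((d : ℝ) - 1) ^ (n - 1) / (d : ℝ) ^ n)) *
          ((d : ℝ) ^ 3 * ((d : ℝ) + 7)) ^ n := by
  refine ⟨⟨9, fun d hd => ?_⟩, ?_⟩
  · rcases hd.eq_or_lt with rfl | hd2
    -- For `d = 1` the logarithm vanishes, so no constant helps and `p₁ ≤ 1` is needed exactly.
    · simpa using PerfectForms.numPerfect_one_le
    · refine ((PerfectForms.finite_and_numPerfect_le hd).2.trans
        (PerfectForms.explicitBound_le hd2)).trans (le_of_eq ?_)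
      have hd0 : (0 : ℝ) < d := by exact_mod_cast hd
      rw [← Real.rpow_natCast, Real.rpow_def_of_pos hd0]
      push_cast
      congr 1
      ring
  · rintro d _ hd rfl
    exact PerfectForms.finite_and_numPerfect_le hd
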